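/- Let $h<k$ be relatively prime integers with $k\ge 1$, let $x\in\mathbb C$ with $|x|<1$, and let $$P(x,u)=\prod_{j=1}^\infty \frac{1}{1-xu^j}\quad(|u|<1),\qquad \mathrm{Li}_2(y)=\sum_{n=1}^\infty \frac{y^n}{n^2}\quad(|y|<1),$$ $$w_{h,k}=\frac1{2k}\ln(1-x^k)+\sum_{l\ge1,\;k\nmid l}\frac{x^l}{l}\,\frac{1}{e^{-2\pi i l h/k}-1},\qquad \Psi_k(z)=\frac{\mathrm{Li}_2(x^k)}{2\pi k^2}\,\frac1z ,$$ where $\ln$ is the principal logarithm; the series for $w_{h,k}$ converges absolutely. The double series $$Q_{h,k}(s)=\sum_{m\ge1}\sum_{l\ge1}\frac{x^l e^{2\pi i l m h/k}}{l}\,(lm)^{-s}$$ converges absolutely for $\Re(s)>1$ and extends to a holomorphic function on $\mathbb C\setminus\{1\}$, again denoted $Q_{h,k}$, with $\lim_{s\to1}(s-1)Q_{h,k}(s)=\mathrm{Li}_2(x^k)/k^2$ and $Q_{h,k}(0)=w_{h,k}$; if $x\neq0$, then $Q_{h,k}$ has a simple pole at $s=1$ (with residue $\mathrm{Li}_2(x^k)/k^2$).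 For every $z\in\mathbb C$ with $\Re(z)>0$ the product defining $P\left(x,e^{2\pi i(h/k+iz)}\right)$ converges, the integral $$j_{h,k}(z)=\frac1{2\pi i}\int_{-\frac34-i\infty}^{-\frac34+i\infty}Q_{h,k}(s)\,\Gamma(s)\,(2\pi z)^{-s}\,ds$$ (with the principal branch of the power) converges absolutely, and $$P\left(x,e^{2\pi i(h/k+iz)}\right)=e^{w_{h,k}}\,e^{\Psi_k(z)}\,e^{j_{h,k}(z)} .$$ -/

import Mathlib

noncomputable section

/-- The generating function `P(x,u) = ∏_{j ≥ 1} 1 / (1 - x u ^ j)`. -/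
def partitionGF (x u : ℂ) : ℂ := ∏' j : ℕ+, 1 / (1 - x * u ^ (j : ℕ))

/-- The dilogarithm `Li₂(y) = ∑_{n ≥ 1} y ^ n / n ^ 2`, used for `|y| < 1`. -/
def dilog (y : ℂ) : ℂ := ∑' n : ℕ+, y ^ (n : ℕ) / ((n : ℕ) : ℂ) ^ 2

/-- The point `e^{2πi(h/k + iz)}`. -/
def cuspPoint (h : ℤ) (k : ℕ) (z : ℂ) : ℂ :=
  Complex.exp (2 * Real.pi * Complex.I * ((h : ℂ) / (k : ℂ) + Complex.I * z))

/-- The term with indices `m = p.1`, `l = p.2` of the double series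
`∑_{m ≥ 1} ∑_{l ≥ 1} (x ^ l e^{2πi l m h / k} / l) (l m)^{-s}`. -/
def qTerm (x : ℂ) (h : ℤ) (k : ℕ) (s : ℂ) (p : ℕ+ × ℕ+) : ℂ :=
  x ^ (p.2 : ℕ) *
      Complex.exp (2 * Real.pi * Complex.I * ((p.2 : ℕ) : ℂ) * ((p.1 : ℕ) : ℂ) * (h : ℂ) / (k : ℂ)) /
      ((p.2 : ℕ) : ℂ) *
    (((p.2 : ℕ) : ℂ) * ((p.1 : ℕ) : ℂ)) ^ (-s)

/-- The term `(x ^ l / l) · 1 / (e^{-2πi l h / k} - 1)`. -/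
def wTerm (x : ℂ) (h : ℤ) (k : ℕ) (l : ℕ) : ℂ :=
  x ^ l / (l : ℂ) *
    (1 / (Complex.exp (-(2 * Real.pi * Complex.I * (l : ℂ) * (h : ℂ) / (k : ℂ))) - 1))

/-- `w_{h,k} = (1 / 2k) ln (1 - x ^ k) + ∑_{l ≥ 1, k ∤ l} (x ^ l / l) / (e^{-2πi l h / k} - 1)`.
The index `l = 0` does not occur because `k ∣ 0`. -/
def wConst (x : ℂ) (h : ℤ) (k : ℕ) : ℂ :=
  1 / (2 * (k : ℂ)) * Complex.log (1 - x ^ k) +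
    ∑' l : {l : ℕ // ¬ k ∣ l}, wTerm x h k l

/-- `Ψ_k(z) = Li₂(x ^ k) / (2 π k ^ 2) · 1 / z`. -/
def psiFun (x : ℂ) (k : ℕ) (z : ℂ) : ℂ :=
  dilog (x ^ k) / (2 * Real.pi * (k : ℂ) ^ 2) * (1 / z)

/-- The point `-3/4 + i t` of the line of integration. -/
def linePoint (t : ℝ) : ℂ := -3 / 4 + t * Complex.I

/-- The integrand `Q(s) Γ(s) (2πz)^{-s}`, with the principal power. -/
def jIntegrand (Q : ℂ → ℂ) (z s : ℂ) : ℂ :=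
  Q s * Complex.Gamma s * (2 * Real.pi * z) ^ (-s)

/-- `j(z) = (1 / 2πi) ∫ Q(s) Γ(s) (2πz)^{-s} ds` along the upward vertical line
`s = -3/4 + i t`, `ds = i dt`. -/
def jFun (Q : ℂ → ℂ) (z : ℂ) : ℂ :=
  1 / (2 * Real.pi * Complex.I) * ∫ t : ℝ, jIntegrand Q z (linePoint t) * Complex.I

end

open Complex Filter Topology MeasureTheory Set Asymptotics HurwitzZeta

/-! Expanding `-log (1 - x u^j)` and summing over `j` first turns the logarithm of the product into
`∑_l (x^l / l) K_a(l w)`, where `w = 2πz`, `a = l h / k` and `K_a(w) = 1 / (e^{w - 2πia} - 1)` is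
`expKernel` (`hasProd_partitionGF`). Everything thus reduces to one elementary function.

For `Re s > 1` the Mellin transform of `t ↦ K_a(t w)` is `Γ(s) w^{-s} F(a, s)`, with `F` the
function `expZeta` (`mellin_expKernel`). Near `0`, `K_a(w) = R/w + C + O(w)`. Subtracting `R/(t w) +
C` carries the formula over to `-1 < Re s < 0`, where it is the transform of the difference. Mellin
inversion on `Re s = -3/4`, taken at `t = 1`, then writes `K_a(w)` as `R/w + C` plus an integral
(`expKernel_eq_integral`), without moving any contour. The same continuation yields `F(a, 0) = C`
and the residue `R` of `F(a, ·)` at `1`. The decay needed for inversion comes from rotating the ray,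
not from Stirling's formula (`exists_norm_Gamma_mul_expZeta_le_exp`).

Summed over `l` with the weights `x^l / l`, the constants `C` give `w_{h,k}`, the polar terms give
`Ψ_k(z)` and the integrals give `j_{h,k}(z)`. The function `Q` is `∑_l (x^l / l) l^{-s} F(l h / k,
s)`; since `F` has period `1` in `a`, it is a finite sum over the classes of `l` modulo `k`, which
makes its continuation visible. -/

/-! ### Euler's integral with a complex parameter -/

/-- Euler's integral for `Γ`, along a ray in the right half-plane. -/
theorem integrableOn_cpow_mul_cexp {s w : ℂ} (hs : 0 < s.re) (hw : 0 < w.re) :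
    IntegrableOn (fun t : ℝ => (t : ℂ) ^ (s - 1) * cexp (-(w * t))) (Ioi 0) := by
  have h := integrableOn_rpow_mul_exp_neg_mul_rpow (p := 1) (s := s.re - 1) (b := w.re)
    (by linarith) one_pos hw
  refine Integrable.mono' h ?_ ?_
  · refine ContinuousOn.aestronglyMeasurable (fun t ht => ?_) measurableSet_Ioi
    exact ((continuousAt_ofReal_cpow_const t (s - 1) (Or.inr (ne_of_gt ht))).mul
      (by fun_prop)).continuousWithinAt
  · filter_upwards [ae_restrict_mem measurableSet_Ioi] with t ht
    rw [norm_mul, norm_cpow_eq_rpow_re_of_pos ht, norm_exp]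
    simp

theorem integral_norm_cpow_mul_cexp {s w : ℂ} (hs : 0 < s.re) (hw : 0 < w.re) :
    ∫ t : ℝ in Ioi 0, ‖(t : ℂ) ^ (s - 1) * cexp (-(w * t))‖ =
      (1 / w.re) ^ s.re * Real.Gamma s.re := by
  rw [← Real.integral_rpow_mul_exp_neg_mul_Ioi hs hw]
  refine setIntegral_congr_fun measurableSet_Ioi fun t ht => ?_
  rw [norm_mul, norm_cpow_eq_rpow_re_of_pos ht, norm_exp]
  simp

theorem hasDerivAt_integral_cpow_mul_cexp {s w : ℂ} (hs : 0 < s.re) (hw : 0 < w.re) :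
    HasDerivAt (fun v : ℂ => ∫ t : ℝ in Ioi 0, (t : ℂ) ^ (s - 1) * cexp (-(v * t)))
      (∫ t : ℝ in Ioi 0, (t : ℂ) ^ (s - 1) * (cexp (-(w * t)) * -t)) w := by
  have hw2 : 0 < w.re / 2 := by linarith
  have hball : ∀ v ∈ Metric.ball w (w.re / 2), w.re / 2 < v.re := by
    intro v hv
    have h1 := (abs_re_le_norm (v - w)).trans_lt (mem_ball_iff_norm.1 hv)
    rw [sub_re, abs_lt] at h1
    linarith [h1.1]
  have hint := integrableOn_rpow_mul_exp_neg_mul_rpow (p := 1) (s := s.re) (b := w.re / 2)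
    (by linarith) one_pos hw2
  have hmeas : ∀ v : ℂ, AEStronglyMeasurable
      (fun t : ℝ => (t : ℂ) ^ (s - 1) * cexp (-(v * t))) (volume.restrict (Ioi 0)) := by
    intro v
    refine ContinuousOn.aestronglyMeasurable (fun t ht => ?_) measurableSet_Ioi
    exact ((continuousAt_ofReal_cpow_const t (s - 1) (Or.inr (ne_of_gt ht))).mul
      (by fun_prop)).continuousWithinAt
  refine (hasDerivAt_integral_of_dominated_loc_of_deriv_le
    (bound := fun t : ℝ => t ^ s.re * Real.exp (-(w.re / 2) * t ^ (1 : ℝ)))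
    (F' := fun v t => (t : ℂ) ^ (s - 1) * (cexp (-(v * t)) * -t))
    (Metric.ball_mem_nhds w hw2) (Eventually.of_forall hmeas)
    (integrableOn_cpow_mul_cexp hs hw) ?_ ?_ hint ?_).2
  · have := (hmeas w).mul (Continuous.aestronglyMeasurable (f := fun t : ℝ => -(t : ℂ))
      (by fun_prop))
    simpa only [mul_assoc, Pi.mul_def] using this
  · filter_upwards [ae_restrict_mem measurableSet_Ioi] with t ht v hv
    have ht' : 0 < t := ht
    rw [norm_mul, norm_mul, norm_cpow_eq_rpow_re_of_pos ht, norm_exp, norm_neg, norm_real,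
      Real.norm_of_nonneg ht'.le, Real.rpow_one, sub_re, one_re, Real.rpow_sub_one ht'.ne']
    have : Real.exp (-(v * t)).re ≤ Real.exp (-(w.re / 2) * t) := by
      apply Real.exp_le_exp.2
      simp only [neg_re, mul_re, ofReal_re, ofReal_im, mul_zero, sub_zero, neg_mul, neg_le_neg_iff]
      exact mul_le_mul_of_nonneg_right (hball v hv).le ht'.le
    calc t ^ s.re / t * (Real.exp (-(v * t)).re * t) = t ^ s.re * Real.exp (-(v * t)).re := by
          field_simp
      _ ≤ _ := by gcongr
  · filter_upwards with t v hv
    have h1 : HasDerivAt (fun v : ℂ => -(v * t)) (-t) v := by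
      simpa using! ((hasDerivAt_id v).mul_const (t : ℂ)).neg
    exact h1.cexp.const_mul _

/-- Both sides are holomorphic in `w` on the right half-plane and agree for real `w > 0`, so the
identity theorem applies. -/
theorem integral_cpow_mul_cexp {s w : ℂ} (hs : 0 < s.re) (hw : 0 < w.re) :
    ∫ t : ℝ in Ioi 0, (t : ℂ) ^ (s - 1) * cexp (-(w * t)) = Gamma s * w ^ (-s) := by
  have hopen : IsOpen {v : ℂ | 0 < v.re} := isOpen_lt continuous_const continuous_re
  have hA : AnalyticOnNhd ℂ
      (fun v : ℂ => ∫ t : ℝ in Ioi 0, (t : ℂ) ^ (s - 1) * cexp (-(v * t))) {v : ℂ | 0 < v.re} :=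
    DifferentiableOn.analyticOnNhd (fun v hv =>
      (hasDerivAt_integral_cpow_mul_cexp hs hv).differentiableAt.differentiableWithinAt) hopen
  have hB : AnalyticOnNhd ℂ (fun v : ℂ => Gamma s * v ^ (-s)) {v : ℂ | 0 < v.re} :=
    DifferentiableOn.analyticOnNhd (fun v hv =>
      ((differentiableAt_id.cpow_const (Or.inl hv)).const_mul _).differentiableWithinAt) hopen
  refine hA.eqOn_of_preconnected_of_frequently_eq hB
    (convex_halfSpace_re_gt 0).isPreconnected (z₀ := 1) (by simp) ?_ hw
  have hfreq : ∃ᶠ r : ℝ in 𝓝[≠] 1, 0 < r :=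
    (((eventually_gt_nhds (zero_lt_one' ℝ)).filter_mono nhdsWithin_le_nhds)).frequently
  have htend : Tendsto (fun r : ℝ => (r : ℂ)) (𝓝[≠] 1) (𝓝[≠] 1) := by
    refine tendsto_nhdsWithin_of_tendsto_nhds_of_eventually_within _ ?_ ?_
    · simpa using (continuous_ofReal.tendsto (1 : ℝ)).mono_left nhdsWithin_le_nhds
    · filter_upwards [self_mem_nhdsWithin] with r hr
      simpa using hr
  refine htend.frequently (hfreq.mono fun r hr => ?_)
  have := Complex.integral_cpow_mul_exp_neg_mul_Ioi hs hr
  rw [this, one_div, inv_cpow _ _ (by rw [arg_ofReal_of_nonneg hr.le]; exact Real.pi_pos.ne),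
    cpow_neg, mul_comm]

/-! ### The kernel and its behaviour at `0` and at infinity -/

/-- The function `1 / (e^{w - 2πia} - 1)`, the sum of `∑_{n ≥ 1} e^{2πina} e^{-nw}`
for `0 < Re w`. -/
noncomputable def expKernel (a : ℝ) (w : ℂ) : ℂ := 1 / (cexp (w - 2 * Real.pi * I * a) - 1)

open Classical in
/-- The residue at `0` of `expKernel a`. -/
noncomputable def expKernelResidue (a : ℝ) : ℂ :=
  if cexp (2 * Real.pi * I * a) = 1 then 1 else 0

open Classical in
/-- The constant term at `0` of `expKernel a`. -/
noncomputable def expKernelConst (a : ℝ) : ℂ :=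
  if cexp (2 * Real.pi * I * a) = 1 then -1 / 2 else 1 / (cexp (-(2 * Real.pi * I * a)) - 1)

theorem norm_cexp_two_pi_I_mul (a : ℝ) : ‖cexp (2 * Real.pi * I * a)‖ = 1 := by
  rw [show 2 * Real.pi * I * (a : ℂ) = ((2 * Real.pi * a : ℝ) : ℂ) * I by push_cast; ring]
  exact norm_exp_ofReal_mul_I _

theorem norm_cexp_sub_two_pi_I_mul (a : ℝ) (w : ℂ) :
    ‖cexp (w - 2 * Real.pi * I * a)‖ = Real.exp w.re := by
  rw [exp_sub, norm_div, norm_cexp_two_pi_I_mul, div_one, norm_exp]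

theorem cexp_sub_two_pi_I_mul_ne_one {w : ℂ} (a : ℝ) (hw : 0 < w.re) :
    cexp (w - 2 * Real.pi * I * a) - 1 ≠ 0 := by
  intro h
  have h1 := norm_cexp_sub_two_pi_I_mul a w
  rw [sub_eq_zero.1 h, norm_one] at h1
  exact absurd h1 (Real.one_lt_exp_iff.2 hw).ne

theorem hasSum_expKernel {w : ℂ} (a : ℝ) (hw : 0 < w.re) :
    HasSum (fun n : ℕ => cexp (2 * Real.pi * I * a * (n + 1 : ℕ)) * cexp (-((n + 1 : ℕ) * w)))
      (expKernel a w) := by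
  set q := cexp (-(w - 2 * Real.pi * I * a)) with hq
  have hq1 : ‖q‖ < 1 := by
    rw [hq, exp_neg, norm_inv, norm_cexp_sub_two_pi_I_mul]
    exact inv_lt_one_of_one_lt₀ (Real.one_lt_exp_iff.2 hw)
  have h := (hasSum_geometric_of_norm_lt_one hq1).mul_left q
  have hne := cexp_sub_two_pi_I_mul_ne_one a hw
  convert! h using 1
  · ext n
    rw [← pow_succ', hq, ← exp_nat_mul, ← exp_add]
    congr 1
    ring
  · rw [expKernel, hq, exp_neg]
    have h0 := exp_ne_zero (w - 2 * Real.pi * I * a)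
    have : 1 - (cexp (w - 2 * Real.pi * I * a))⁻¹ ≠ 0 := by
      intro h'
      apply hne
      rw [sub_eq_zero] at h' ⊢
      rw [eq_comm, inv_eq_one] at h'
      exact h'
    field_simp

theorem norm_expKernel_le {w : ℂ} (a : ℝ) (hw : 0 < w.re) :
    ‖expKernel a w‖ ≤ 1 / (Real.exp w.re - 1) := by
  rw [expKernel, norm_div, norm_one]
  have h1 : 0 < Real.exp w.re - 1 := sub_pos.2 (Real.one_lt_exp_iff.2 hw)
  refine one_div_le_one_div_of_le h1 ?_
  have := norm_sub_norm_le (cexp (w - 2 * Real.pi * I * a)) 1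
  rwa [norm_cexp_sub_two_pi_I_mul, norm_one] at this

theorem continuousAt_expKernel {w : ℂ} (a : ℝ) (hw : 0 < w.re) : ContinuousAt (expKernel a) w := by
  unfold expKernel
  exact continuousAt_const.div (by fun_prop) (cexp_sub_two_pi_I_mul_ne_one a hw)

theorem expKernel_isBigO_exp {w : ℂ} (a : ℝ) (hw : 0 < w.re) :
    (fun t : ℝ => expKernel a (t * w)) =O[atTop] fun t => Real.exp (-w.re * t) := by
  -- Once `t * w.re ≥ 1`, the exponential `E` is at least `2`, so `E - 1 ≥ E / 2`.
  refine IsBigO.of_bound 2 ?_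
  filter_upwards [eventually_ge_atTop (1 / w.re), eventually_gt_atTop 0] with t ht ht0
  have h1 : 1 ≤ t * w.re := by rwa [div_le_iff₀ hw] at ht
  have hre : ((t : ℂ) * w).re = t * w.re := by simp
  have hE : 2 ≤ Real.exp (t * w.re) := by linarith [Real.add_one_le_exp (t * w.re)]
  refine (norm_expKernel_le a (by rw [hre]; positivity)).trans ?_
  rw [hre, Real.norm_eq_abs, Real.abs_exp, neg_mul, Real.exp_neg, mul_comm w.re t,
    div_le_iff₀ (by linarith)]
  have h3 : (Real.exp (t * w.re))⁻¹ * Real.exp (t * w.re) = 1 := inv_mul_cancel₀ (by positivity)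
  have h4 : (Real.exp (t * w.re))⁻¹ ≤ 2⁻¹ := inv_anti₀ (by norm_num) hE
  nlinarith

theorem inv_exp_sub_one_isBigO :
    (fun w : ℂ => 1 / (cexp w - 1) - 1 / w - -1 / 2) =O[𝓝[≠] 0] fun w => w := by
  -- Over a common denominator the numerator is at most `3‖w‖³` and the denominator at least `‖w‖²`,
  -- so any constant from `3` on would do.
  refine IsBigO.of_bound 5 ?_
  have hball : ∀ᶠ w : ℂ in 𝓝[≠] 0, ‖w‖ < 1 / 2 :=
    nhdsWithin_le_nhds (continuous_norm.tendsto _ |>.eventually_lt_const (by norm_num))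
  filter_upwards [hball, self_mem_nhdsWithin] with w hw hw0
  have hw0 : w ≠ 0 := hw0
  have hn : 0 < ‖w‖ := norm_pos_iff.2 hw0
  have h1 : ‖cexp w - 1 - w‖ ≤ ‖w‖ ^ 2 := norm_exp_sub_one_sub_id_le (by linarith)
  have h2 : ‖cexp w - (1 + w + w ^ 2 / 2)‖ ≤ ‖w‖ ^ 3 := by
    have := exp_bound (x := w) (by linarith) (n := 3) (by norm_num)
    norm_num [Finset.sum_range_succ, Nat.factorial] at this
    refine this.trans ?_
    have : 0 ≤ ‖w‖ ^ 3 := by positivity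
    linarith
  have h3 : ‖w‖ / 2 ≤ ‖cexp w - 1‖ := by
    have := norm_sub_norm_le w (w - (cexp w - 1))
    rw [sub_sub_cancel, norm_sub_rev w] at this
    nlinarith
  have hE : cexp w - 1 ≠ 0 := norm_pos_iff.1 (by linarith)
  have key : 1 / (cexp w - 1) - 1 / w - -1 / 2 =
      (w * (cexp w - 1 - w) - 2 * (cexp w - (1 + w + w ^ 2 / 2))) / (2 * w * (cexp w - 1)) := by
    field_simp
    ring
  rw [key, norm_div, norm_mul, norm_mul, Complex.norm_ofNat, div_le_iff₀ (by positivity)]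
  have h4 : ‖w * (cexp w - 1 - w) - 2 * (cexp w - (1 + w + w ^ 2 / 2))‖ ≤ 3 * ‖w‖ ^ 3 := by
    refine (norm_sub_le _ _).trans ?_
    rw [norm_mul, norm_mul, Complex.norm_ofNat]
    nlinarith
  refine h4.trans ?_
  have h5 : ‖w‖ ^ 2 * (‖w‖ / 2) ≤ ‖w‖ ^ 2 * ‖cexp w - 1‖ := by gcongr
  nlinarith [pow_pos hn 3]

/-- If `e^{2πia} = 1` this is the expansion of `1 / (e^w - 1)`; otherwise the kernel is
differentiable at `0` and the constant is its value there. -/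
theorem expKernel_sub_isBigO (a : ℝ) :
    (fun w : ℂ => expKernel a w - expKernelResidue a / w - expKernelConst a)
      =O[𝓝[≠] 0] fun w => w := by
  unfold expKernelResidue expKernelConst expKernel
  by_cases h : cexp (2 * Real.pi * I * a) = 1
  · simp only [exp_sub, h, div_one, if_true]
    exact inv_exp_sub_one_isBigO
  · simp only [h, if_false, zero_div, sub_zero]
    have hne : cexp ((0 : ℂ) - 2 * Real.pi * I * a) - 1 ≠ 0 := by
      rw [zero_sub, exp_neg, sub_ne_zero, Ne, inv_eq_one]
      exact h
    have hd : DifferentiableAt ℂ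
        (fun w : ℂ => 1 / (cexp (w - 2 * Real.pi * I * a) - 1)) 0 :=
      (differentiableAt_const _).div (by fun_prop) hne
    have := hd.isBigO_sub
    simp only [zero_sub, sub_zero] at this
    exact this.mono nhdsWithin_le_nhds

/-! ### Mellin transform of the kernel for `Re s > 1` -/

theorem ofReal_mul_cpow {r : ℝ} (hr : 0 < r) {w : ℂ} (hw : w ≠ 0) (s : ℂ) :
    ((r : ℂ) * w) ^ s = (r : ℂ) ^ s * w ^ s := by
  have hr' : (r : ℂ) ≠ 0 := ofReal_ne_zero.2 hr.ne'
  rw [cpow_def_of_ne_zero (mul_ne_zero hr' hw), cpow_def_of_ne_zero hr', cpow_def_of_ne_zero hw,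
    log_ofReal_mul hr hw, ofReal_log hr.le, ← exp_add, add_mul]

theorem natCast_mul_cpow {n : ℕ} (hn : n ≠ 0) {w : ℂ} (hw : w ≠ 0) (s : ℂ) :
    ((n : ℂ) * w) ^ s = (n : ℂ) ^ s * w ^ s := by
  simpa using ofReal_mul_cpow (r := n) (by positivity) hw s

theorem natCast_mul_re (n : ℕ) (w : ℂ) : ((n : ℂ) * w).re = n * w.re := by
  rw [← ofReal_natCast, re_ofReal_mul]

/-- The geometric series is integrated term by term; the integrals of the norms are a constant times
`n^{-Re s}`, whence `Re s > 1`. -/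
theorem mellin_expKernel {w s : ℂ} (a : ℝ) (hw : 0 < w.re) (hs : 1 < s.re) :
    mellin (fun t : ℝ => expKernel a (t * w)) s = Gamma s * w ^ (-s) * expZeta a s := by
  have hw0 := ne_zero_of_re_pos hw
  have hs0 : 0 < s.re := by linarith
  set F : ℕ → ℝ → ℂ := fun n t =>
    cexp (2 * Real.pi * I * a * (n + 1 : ℕ)) * (t ^ (s - 1) * cexp (-((n + 1 : ℕ) * w * t))) with hF
  have hre : ∀ n : ℕ, 0 < (((n + 1 : ℕ) : ℂ) * w).re := fun n => by
    rw [natCast_mul_re]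
    positivity
  have hint : ∀ n, IntegrableOn (F n) (Ioi 0) := fun n =>
    (integrableOn_cpow_mul_cexp hs0 (hre n)).const_mul _
  have hphase : ∀ n : ℕ, ‖cexp (2 * Real.pi * I * a * (n + 1 : ℕ))‖ = 1 := fun n => by
    simpa [mul_assoc] using norm_cexp_two_pi_I_mul (a * (n + 1 : ℕ))
  have hnorm : ∀ n : ℕ, ∫ t in Ioi 0, ‖F n t‖ =
      Real.Gamma s.re * (1 / w.re) ^ s.re * (1 / ((n + 1 : ℕ) : ℝ) ^ s.re) := fun n => by
    simp only [hF, norm_mul (cexp (2 * Real.pi * I * a * _)), hphase, one_mul]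
    rw [integral_norm_cpow_mul_cexp hs0 (hre n), natCast_mul_re, ← one_div_mul_one_div,
      Real.mul_rpow (by positivity) (by positivity), Real.div_rpow zero_le_one (by positivity),
      Real.one_rpow]
    ring
  have hsum : Summable fun n => ∫ t in Ioi 0, ‖F n t‖ := by
    simp only [hnorm]
    exact ((summable_nat_add_iff 1).2 (Real.summable_one_div_nat_rpow.2 hs)).mul_left _
  have h1 := hasSum_integral_of_summable_integral_norm hint hsum
  have h2 : ∫ t in Ioi 0, ∑' n, F n t = mellin (fun t : ℝ => expKernel a (t * w)) s := by
    refine setIntegral_congr_fun measurableSet_Ioi fun t ht => ?_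
    have htw : 0 < ((t : ℂ) * w).re := by
      rw [re_ofReal_mul]
      exact mul_pos ht hw
    beta_reduce
    rw [smul_eq_mul, ← (hasSum_expKernel a htw).tsum_eq, ← tsum_mul_left]
    refine tsum_congr fun n => ?_
    rw [hF]
    ring_nf
  have h3 : HasSum (fun n => ∫ t in Ioi 0, F n t) (Gamma s * w ^ (-s) * expZeta a s) := by
    have := (hasSum_nat_add_iff' 1).2 (hasSum_expZeta_of_one_lt_re a hs)
    have hs' : s ≠ 0 := ne_zero_of_re_pos hs0
    simp only [Finset.sum_range_one, Nat.cast_zero, zero_cpow hs', div_zero, sub_zero] at this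
    convert! this.mul_left (Gamma s * w ^ (-s)) using 2 with n
    rw [hF, integral_const_mul, integral_cpow_mul_cexp hs0 (hre n),
      natCast_mul_cpow n.succ_ne_zero hw0, cpow_neg ((n + 1 : ℕ) : ℂ)]
    ring
  rw [← h2]
  exact h1.unique h3

/-! ### Removal of the polar part and continuation to `Re s > -1` -/

theorem hasMellin_cpow_Ioi {a s : ℂ} (hs : s.re + a.re < 0) :
    HasMellin (indicator (Ioi 1) (fun t : ℝ => (t : ℂ) ^ a)) s (-1 / (s + a)) := by
  have hre : (s + a - 1).re < -1 := by simp; linarith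
  have hEq : (fun t : ℝ => (t : ℂ) ^ (s - 1) • indicator (Ioi 1) (fun t : ℝ => (t : ℂ) ^ a) t) =
      indicator (Ioi 1) (fun t : ℝ => (t : ℂ) ^ (s + a - 1)) := by
    ext t
    by_cases ht : t ∈ Ioi (1 : ℝ)
    · have : (t : ℂ) ≠ 0 := ofReal_ne_zero.2 (by linarith [mem_Ioi.1 ht])
      rw [indicator_of_mem ht, indicator_of_mem ht, smul_eq_mul, ← cpow_add _ _ this]
      ring_nf
    · rw [indicator_of_notMem ht, indicator_of_notMem ht, smul_zero]
  have hI : Ioi (1 : ℝ) ∩ Ioi 0 = Ioi 1 := by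
    rw [Ioi_inter_Ioi]
    simp
  constructor
  · rw [MellinConvergent, hEq, IntegrableOn, integrable_indicator_iff measurableSet_Ioi,
      IntegrableOn, Measure.restrict_restrict measurableSet_Ioi, hI]
    exact integrableOn_Ioi_cpow_of_lt hre one_pos
  · rw [mellin, hEq, setIntegral_indicator measurableSet_Ioi, inter_comm, hI,
      integral_Ioi_cpow_of_lt hre one_pos]
    simp

/-- The principal part of `t ↦ expKernel a (t * w)` at `0`, together with its constant term. -/
noncomputable def expKernelPolar (a : ℝ) (w : ℂ) (t : ℝ) : ℂ :=
  expKernelResidue a / w * (t : ℂ) ^ (-1 : ℂ) + expKernelConst a * (t : ℂ) ^ (0 : ℂ)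

theorem hasMellin_expKernelPolar_Ioc (a : ℝ) (w : ℂ) {s : ℂ} (hs : 1 < s.re) :
    HasMellin (indicator (Ioc 0 1) (expKernelPolar a w)) s
      (expKernelResidue a / w / (s - 1) + expKernelConst a / s) := by
  have h1 := hasMellin_cpow_Ioc (-1) (s := s) (by simp; linarith)
  have h0 := hasMellin_cpow_Ioc 0 (s := s) (by simp; linarith)
  have h1' := hasMellin_const_smul h1.1 (expKernelResidue a / w)
  have h0' := hasMellin_const_smul h0.1 (expKernelConst a)
  have h := hasMellin_add h1'.1 h0'.1
  rw [h1'.2, h0'.2, h1.2, h0.2] at h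
  convert! h using 1
  · ext t
    by_cases ht : t ∈ Ioc (0 : ℝ) 1 <;> simp [ht, expKernelPolar]
  · simp [div_eq_mul_inv, sub_eq_add_neg]

/-- On `(1, ∞)` the polar part has a transform only to the left of `0`, and it is minus the rational
function coming from `(0, 1]`. The two cancel in the strip `-1 < Re s < 0`. -/
theorem hasMellin_expKernelPolar_Ioi (a : ℝ) (w : ℂ) {s : ℂ} (hs : s.re < 0) :
    HasMellin (indicator (Ioi 1) (expKernelPolar a w)) s
      (-(expKernelResidue a / w / (s - 1) + expKernelConst a / s)) := by
  have h1 := hasMellin_cpow_Ioi (a := -1) (s := s) (by simp; linarith)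
  have h0 := hasMellin_cpow_Ioi (a := 0) (s := s) (by simp; linarith)
  have h1' := hasMellin_const_smul h1.1 (expKernelResidue a / w)
  have h0' := hasMellin_const_smul h0.1 (expKernelConst a)
  have h := hasMellin_add h1'.1 h0'.1
  rw [h1'.2, h0'.2, h1.2, h0.2] at h
  convert! h using 1
  · ext t
    by_cases ht : t ∈ Ioi (1 : ℝ) <;> simp [ht, expKernelPolar]
  · simp [div_eq_mul_inv, sub_eq_add_neg]
    ring

/-- `t ↦ expKernel a (t * w)` with its principal part and constant term removed on `(0, 1]`. -/
noncomputable def expKernelTrunc (a : ℝ) (w : ℂ) (t : ℝ) : ℂ :=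
  expKernel a (t * w) - indicator (Ioc 0 1) (expKernelPolar a w) t

theorem continuousOn_expKernel_ray {w : ℂ} (a : ℝ) (hw : 0 < w.re) :
    ContinuousOn (fun t : ℝ => expKernel a (t * w)) (Ioi 0) := by
  intro t ht
  have htw : 0 < ((t : ℂ) * w).re := by
    rw [re_ofReal_mul]
    exact mul_pos ht hw
  exact (ContinuousAt.comp (f := fun t : ℝ => (t : ℂ) * w) (continuousAt_expKernel a htw)
    (by fun_prop)).continuousWithinAt

theorem continuousOn_expKernelPolar (a : ℝ) (w : ℂ) :
    ContinuousOn (expKernelPolar a w) (Ioi 0) := fun t ht =>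
  (((continuousAt_ofReal_cpow_const t _ (Or.inr (ne_of_gt ht))).const_mul _).add
    ((continuousAt_ofReal_cpow_const t _ (Or.inr (ne_of_gt ht))).const_mul _)).continuousWithinAt

theorem locallyIntegrableOn_expKernelTrunc {w : ℂ} (a : ℝ) (hw : 0 < w.re) :
    LocallyIntegrableOn (expKernelTrunc a w) (Ioi 0) := by
  have hker := (continuousOn_expKernel_ray a hw).locallyIntegrableOn (μ := volume)
    measurableSet_Ioi
  refine hker.sub ?_
  intro t ht
  obtain ⟨u, hu, h⟩ :=
    (continuousOn_expKernelPolar a w).locallyIntegrableOn (μ := volume) measurableSet_Ioi t ht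
  exact ⟨u, hu, h.indicator measurableSet_Ioc⟩

theorem expKernelTrunc_isBigO_atTop {w : ℂ} (a : ℝ) (hw : 0 < w.re) :
    expKernelTrunc a w =O[atTop] fun t => Real.exp (-w.re * t) := by
  refine (expKernel_isBigO_exp a hw).congr' ?_ EventuallyEq.rfl
  filter_upwards [eventually_gt_atTop 1] with t ht
  have : t ∉ Ioc (0 : ℝ) 1 := fun h => by linarith [h.2]
  simp [expKernelTrunc, this]

/-- The exponent is written `-(-1)` so that the Mellin convergence criterion reads off the abscissa
`-1`. -/
theorem expKernel_sub_polar_isBigO_zero {w : ℂ} (a : ℝ) (hw : 0 < w.re) :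
    (fun t : ℝ => expKernel a (t * w) - expKernelPolar a w t)
      =O[𝓝[>] 0] fun t => t ^ (-(-1) : ℝ) := by
  have hw0 := ne_zero_of_re_pos hw
  have htend : Tendsto (fun t : ℝ => (t : ℂ) * w) (𝓝[>] 0) (𝓝[≠] 0) := by
    refine tendsto_nhdsWithin_of_tendsto_nhds_of_eventually_within _ ?_ ?_
    · have : Continuous fun t : ℝ => (t : ℂ) * w := by fun_prop
      simpa using (this.tendsto 0).mono_left nhdsWithin_le_nhds
    · filter_upwards [self_mem_nhdsWithin] with t ht
      exact mul_ne_zero (ofReal_ne_zero.2 (ne_of_gt ht)) hw0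
  have h := (expKernel_sub_isBigO a).comp_tendsto htend
  refine (h.congr_left fun t => ?_).trans ?_
  · simp only [Function.comp_apply, expKernelPolar, cpow_neg_one, cpow_zero]
    rw [mul_comm (t : ℂ) w, ← div_div]
    ring
  · refine IsBigO.of_bound ‖w‖ (Eventually.of_forall fun t => ?_)
    simp [mul_comm]

theorem expKernelTrunc_isBigO_zero {w : ℂ} (a : ℝ) (hw : 0 < w.re) :
    expKernelTrunc a w =O[𝓝[>] 0] fun t => t ^ (-(-1) : ℝ) := by
  refine (expKernel_sub_polar_isBigO_zero a hw).congr' ?_ EventuallyEq.rfl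
  filter_upwards [self_mem_nhdsWithin, nhdsWithin_le_nhds (eventually_lt_nhds (zero_lt_one' ℝ))]
    with t ht ht1
  have : t ∈ Ioc (0 : ℝ) 1 := ⟨ht, le_of_lt ht1⟩
  simp [expKernelTrunc, this]

theorem mellinConvergent_expKernelTrunc {w s : ℂ} (a : ℝ) (hw : 0 < w.re) (hs : -1 < s.re) :
    MellinConvergent (expKernelTrunc a w) s :=
  mellinConvergent_of_isBigO_rpow_exp hw (locallyIntegrableOn_expKernelTrunc a hw)
    (expKernelTrunc_isBigO_atTop a hw) (expKernelTrunc_isBigO_zero a hw) hs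

theorem differentiableAt_mellin_expKernelTrunc {w s : ℂ} (a : ℝ) (hw : 0 < w.re)
    (hs : -1 < s.re) : DifferentiableAt ℂ (mellin (expKernelTrunc a w)) s :=
  mellin_differentiableAt_of_isBigO_rpow_exp hw (locallyIntegrableOn_expKernelTrunc a hw)
    (expKernelTrunc_isBigO_atTop a hw) (expKernelTrunc_isBigO_zero a hw) hs

/-- The region is a union of five convex pieces, glued one at a time at an explicit common point. -/
theorem isPreconnected_re_gt_neg_one_diff :
    IsPreconnected {s : ℂ | -1 < s.re ∧ s ≠ 0 ∧ s ≠ 1} := by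
  have up := (convex_halfSpace_re_gt (-1)).inter (convex_halfSpace_im_gt 0) |>.isPreconnected
  have down := (convex_halfSpace_re_gt (-1)).inter (convex_halfSpace_im_lt 0) |>.isPreconnected
  have right := (convex_halfSpace_re_gt 1).isPreconnected
  have mid := (convex_halfSpace_re_gt 0).inter (convex_halfSpace_re_lt 1) |>.isPreconnected
  have left := (convex_halfSpace_re_gt (-1)).inter (convex_halfSpace_re_lt 0) |>.isPreconnected
  have h1 := up.union (2 + I) (by simp; norm_num) (by simp) right
  have h2 := h1.union (2 - I) (by simp) (by simp; norm_num) down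
  have h3 := h2.union (1 / 2 + I) (by simp; norm_num) (by simp; norm_num) mid
  have h4 := h3.union (-1 / 2 + I) (by simp; norm_num) (by simp; norm_num) left
  convert h4 using 1
  ext s
  simp only [mem_ofPred_eq, mem_union, mem_inter_iff, ne_eq, Complex.ext_iff, zero_re, zero_im,
    one_re, one_im]
  clear * -
  generalize s.re = x
  generalize s.im = y
  grind

/-- The continuation of `Γ(s) w^{-s} ∑ e^{2πina} n^{-s}` to `-1 < Re s`. -/
theorem Gamma_mul_expZeta_eq {w s : ℂ} (a : ℝ) (hw : 0 < w.re) (hs : -1 < s.re) (hs0 : s ≠ 0)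
    (hs1 : s ≠ 1) :
    Gamma s * w ^ (-s) * expZeta a s = mellin (expKernelTrunc a w) s +
      (expKernelResidue a / w / (s - 1) + expKernelConst a / s) := by
  have hw0 := ne_zero_of_re_pos hw
  have hopen : IsOpen {s : ℂ | -1 < s.re ∧ s ≠ 0 ∧ s ≠ 1} :=
    (isOpen_lt continuous_const continuous_re).inter (isOpen_ne.inter isOpen_ne)
  have hA : AnalyticOnNhd ℂ (fun s => Gamma s * w ^ (-s) * expZeta a s)
      {s : ℂ | -1 < s.re ∧ s ≠ 0 ∧ s ≠ 1} := by
    refine DifferentiableOn.analyticOnNhd (fun s hs => ?_) hopen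
    have hG : DifferentiableAt ℂ Gamma s := by
      refine differentiableAt_Gamma s fun m hm => ?_
      rcases Nat.eq_zero_or_pos m with rfl | hm0
      · exact hs.2.1 (by simpa using hm)
      · have h1 := hs.1
        rw [hm, neg_re, natCast_re] at h1
        have : (1 : ℝ) ≤ m := by exact_mod_cast hm0
        linarith
    exact ((hG.mul (differentiableAt_id.neg.const_cpow (Or.inl hw0))).mul
      (differentiableAt_expZeta a s (Or.inl hs.2.2))).differentiableWithinAt
  have hB : AnalyticOnNhd ℂ (fun s => mellin (expKernelTrunc a w) s +
      (expKernelResidue a / w / (s - 1) + expKernelConst a / s))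
      {s : ℂ | -1 < s.re ∧ s ≠ 0 ∧ s ≠ 1} := by
    refine DifferentiableOn.analyticOnNhd (fun s hs => ?_) hopen
    have hs1' : s - 1 ≠ 0 := sub_ne_zero.2 hs.2.2
    have hs0' : s ≠ 0 := hs.2.1
    exact ((differentiableAt_mellin_expKernelTrunc a hw hs.1).add
      (by fun_prop (disch := assumption))).differentiableWithinAt
  -- Near `2` both transforms converge: the truncated kernel plus its polar part on `(0, 1]` is the
  -- kernel itself.
  refine hA.eqOn_of_preconnected_of_eventuallyEq hB isPreconnected_re_gt_neg_one_diff (z₀ := 2)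
    (by norm_num) ?_ ⟨hs, hs0, hs1⟩
  have : {s : ℂ | 1 < s.re} ∈ 𝓝 (2 : ℂ) :=
    (isOpen_lt continuous_const continuous_re).mem_nhds (by simp)
  filter_upwards [this] with s hs
  have hs' : 1 < s.re := hs
  have hpol := hasMellin_expKernelPolar_Ioc a w hs
  have h := hasMellin_add (mellinConvergent_expKernelTrunc (s := s) a hw (by linarith)) hpol.1
  rw [← mellin_expKernel a hw hs, ← hpol.2, ← h.2]
  congr 1
  ext t
  simp [expKernelTrunc]

/-! ### Value at `0` and residue at `1` of the exponential zeta function -/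

/-- Multiply the continuation formula with `w = 1` by `s` and let `s → 0`: `s Γ(s) → 1` on the left,
and only the term `C / s` survives on the right. -/
theorem expZeta_apply_zero (a : ℝ) : expZeta a 0 = expKernelConst a := by
  have hev : ∀ᶠ s : ℂ in 𝓝[≠] 0, -1 < s.re ∧ s ≠ 0 ∧ s ≠ 1 := by
    have h1 : ∀ᶠ s : ℂ in 𝓝 0, -1 < s.re :=
      (isOpen_lt continuous_const continuous_re).mem_nhds (by simp)
    have h2 : ∀ᶠ s : ℂ in 𝓝 0, s ≠ 1 := isOpen_ne.mem_nhds (by simp)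
    filter_upwards [nhdsWithin_le_nhds h1, nhdsWithin_le_nhds h2, self_mem_nhdsWithin] with s h1 h2 h3
    exact ⟨h1, h3, h2⟩
  have hF : Tendsto (expZeta a) (𝓝[≠] 0) (𝓝 (expZeta a 0)) :=
    (differentiableAt_expZeta a 0 (by simp)).continuousAt.continuousWithinAt
  have hL := tendsto_self_mul_Gamma_nhds_zero.mul hF
  have hM : ContinuousAt (fun s : ℂ => s * mellin (expKernelTrunc a 1) s +
      (s * (expKernelResidue a / (s - 1)) + expKernelConst a)) 0 := by
    have := (differentiableAt_mellin_expKernelTrunc (s := 0) (w := 1) a (by simp)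
      (by simp)).continuousAt
    refine (continuousAt_id.mul this).add ((continuousAt_id.mul ?_).add continuousAt_const)
    exact continuousAt_const.div (by fun_prop) (by simp)
  have hR := hM.tendsto.mono_left (nhdsWithin_le_nhds (s := {0}ᶜ))
  rw [one_mul] at hL
  have := tendsto_nhds_unique (hL.congr' ?_) hR
  · simpa using this
  · filter_upwards [hev] with s hs
    have h := Gamma_mul_expZeta_eq (w := 1) a (by simp) hs.1 hs.2.1 hs.2.2
    rw [one_cpow, mul_one, div_one] at h
    rw [mul_assoc, h]
    have := hs.2.1
    field_simp

theorem tendsto_sub_one_mul_expZeta (a : ℝ) :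
    Tendsto (fun s : ℂ => (s - 1) * expZeta a s) (𝓝[≠] 1) (𝓝 (expKernelResidue a)) := by
  have hM : ContinuousAt (fun s : ℂ => (Gamma s)⁻¹ * ((s - 1) * mellin (expKernelTrunc a 1) s +
      (expKernelResidue a + (s - 1) * (expKernelConst a / s)))) 1 := by
    have := (differentiableAt_mellin_expKernelTrunc (s := 1) (w := 1) a (by simp)
      (by simp)).continuousAt
    refine ContinuousAt.mul ?_ (ContinuousAt.add ?_ ?_)
    · exact differentiable_one_div_Gamma.continuous.continuousAt
    · exact ContinuousAt.mul (by fun_prop) this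
    · exact continuousAt_const.add (ContinuousAt.mul (by fun_prop)
        (continuousAt_const.div continuousAt_id (by simp)))
  have hR := hM.tendsto.mono_left (nhdsWithin_le_nhds (s := {1}ᶜ))
  simp only [Gamma_one, sub_self, zero_mul, inv_one, one_mul, zero_add, add_zero] at hR
  refine hR.congr' ?_
  have h1 : ∀ᶠ s : ℂ in 𝓝 1, 0 < s.re :=
    (isOpen_lt continuous_const continuous_re).mem_nhds (by simp)
  filter_upwards [nhdsWithin_le_nhds h1, self_mem_nhdsWithin] with s hs hs1
  have hs0 := ne_zero_of_re_pos hs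
  have hs1' : s - 1 ≠ 0 := sub_ne_zero.2 hs1
  have h := Gamma_mul_expZeta_eq (w := 1) a (by simp) (by linarith) hs0 hs1
  have hG := Gamma_ne_zero_of_re_pos hs
  rw [one_cpow, mul_one, div_one] at h
  rw [inv_mul_eq_iff_eq_mul₀ hG, mul_left_comm, h]
  field_simp

/-! ### Mellin inversion on the line `Re s = -3/4` -/

theorem hasMellin_expKernel_sub_polar {w s : ℂ} (a : ℝ) (hw : 0 < w.re) (hs : -1 < s.re)
    (hs0 : s.re < 0) :
    HasMellin (fun t => expKernel a (t * w) - expKernelPolar a w t) s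
      (Gamma s * w ^ (-s) * expZeta a s) := by
  have hpol := hasMellin_expKernelPolar_Ioi a w hs0
  have h := hasMellin_sub (mellinConvergent_expKernelTrunc a hw hs) hpol.1
  have hEq : EqOn (fun t : ℝ => (t : ℂ) ^ (s - 1) • (expKernelTrunc a w t -
      indicator (Ioi 1) (expKernelPolar a w) t))
      (fun t : ℝ => (t : ℂ) ^ (s - 1) • (expKernel a (t * w) - expKernelPolar a w t)) (Ioi 0) := by
    intro t ht
    have ht : 0 < t := ht
    rcases le_or_gt t 1 with h | h
    · simp [expKernelTrunc, ht, h]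
    · simp [expKernelTrunc, h]
  refine ⟨h.1.congr_fun hEq measurableSet_Ioi, ?_⟩
  rw [mellin, ← setIntegral_congr_fun measurableSet_Ioi hEq, ← mellin, h.2, hpol.2,
    Gamma_mul_expZeta_eq a hw hs (by rintro rfl; simp at hs0)
      (by rintro rfl; norm_num at hs0), sub_neg_eq_add]

theorem linePoint_re (t : ℝ) : (linePoint t).re = -3 / 4 := by
  have : linePoint t = ((-3 / 4 : ℝ) : ℂ) + t * I := by simp [linePoint]
  simp [this]

theorem linePoint_im (t : ℝ) : (linePoint t).im = t := by
  have : linePoint t = ((-3 / 4 : ℝ) : ℂ) + t * I := by simp [linePoint]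
  simp [this]

theorem continuous_linePoint : Continuous linePoint := by
  unfold linePoint
  fun_prop

theorem linePoint_ne_one (t : ℝ) : linePoint t ≠ 1 := fun h => by
  have := linePoint_re t
  rw [h] at this
  norm_num at this

theorem linePoint_ne_neg_nat (t : ℝ) (m : ℕ) : linePoint t ≠ -m := fun h => by
  have := linePoint_re t
  rw [h, neg_re, natCast_re] at this
  have h4 : (4 * m : ℝ) = 3 := by linarith
  have : 4 * m = 3 := by exact_mod_cast h4
  omega

/-- The norm of `r^{s-1}` depends only on `Re s`, so one absolute integral bounds the transform on
the whole line. -/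
theorem exists_norm_Gamma_mul_expZeta_le {w : ℂ} (a : ℝ) (hw : 0 < w.re) :
    ∃ C, ∀ t : ℝ,
      ‖Gamma (linePoint t) * w ^ (-linePoint t) * expZeta a (linePoint t)‖ ≤ C := by
  refine ⟨∫ r in Ioi (0 : ℝ), r ^ (-3 / 4 - 1 : ℝ) * ‖expKernel a (r * w) - expKernelPolar a w r‖,
    fun t => ?_⟩
  rw [← (hasMellin_expKernel_sub_polar a hw (by rw [linePoint_re]; norm_num)
    (by rw [linePoint_re]; norm_num)).2, mellin]
  refine (norm_integral_le_integral_norm _).trans_eq ?_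
  refine setIntegral_congr_fun measurableSet_Ioi fun r hr => ?_
  simp only [norm_smul, norm_cpow_eq_rpow_re_of_pos hr, sub_re, one_re, linePoint_re]

theorem norm_cpow_neg_linePoint {w : ℂ} (hw : w ≠ 0) (t : ℝ) :
    ‖w ^ (-linePoint t)‖ = ‖w‖ ^ (3 / 4 : ℝ) * Real.exp (arg w * t) := by
  rw [norm_cpow_of_ne_zero hw, neg_re, neg_im, linePoint_re, linePoint_im, mul_neg, Real.exp_neg,
    div_inv_eq_mul]
  norm_num

/-- For `w = e^{iψ}` with `|ψ| < π/2` one has `‖w^{-s}‖ = e^{ψt}` on the line, so boundedness along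
the rotated ray is exponential decay. The choices `ψ = φ` and `ψ = -φ` serve the two signs of `t`.
-/
theorem exists_norm_Gamma_mul_expZeta_le_exp (a : ℝ) {φ : ℝ} (h0 : 0 ≤ φ) (hφ : φ < Real.pi / 2) :
    ∃ C, 0 ≤ C ∧ ∀ t : ℝ, ‖Gamma (linePoint t) * expZeta a (linePoint t)‖ ≤
      C * Real.exp (-φ * |t|) := by
  have key : ∀ ψ : ℝ, |ψ| < Real.pi / 2 → ∃ C, ∀ t : ℝ,
      ‖Gamma (linePoint t) * expZeta a (linePoint t)‖ * Real.exp (ψ * t) ≤ C := by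
    intro ψ hψ
    have hre : 0 < (cexp (ψ * I)).re := by
      rw [exp_ofReal_mul_I_re]
      exact Real.cos_pos_of_mem_Ioo (abs_lt.1 hψ)
    obtain ⟨C, hC⟩ := exists_norm_Gamma_mul_expZeta_le a hre
    refine ⟨C, fun t => ?_⟩
    have h := hC t
    rw [mul_right_comm, norm_mul, norm_cpow_neg_linePoint (exp_ne_zero _),
      norm_exp_ofReal_mul_I, Real.one_rpow, one_mul, arg_exp_mul_I,
      (toIocMod_eq_self _).2 ⟨by linarith [abs_lt.1 hψ, Real.pi_pos],
        by linarith [abs_lt.1 hψ, Real.pi_pos]⟩] at h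
    exact h
  obtain ⟨C₁, h₁⟩ := key φ (by rwa [abs_of_nonneg h0])
  obtain ⟨C₂, h₂⟩ := key (-φ) (by rwa [abs_neg, abs_of_nonneg h0])
  refine ⟨max C₁ C₂, ?_, fun t => ?_⟩
  · exact le_max_of_le_left (le_trans (by positivity) (h₁ 0))
  · rw [neg_mul, Real.exp_neg, ← div_eq_mul_inv, le_div_iff₀ (Real.exp_pos _)]
    rcases abs_cases t with ⟨h, _⟩ | ⟨h, _⟩
    · rw [h]
      exact (h₁ t).trans (le_max_left _ _)
    · rw [h, mul_neg, ← neg_mul]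
      exact (h₂ t).trans (le_max_right _ _)

theorem integrable_exp_neg_mul_abs {c : ℝ} (hc : 0 < c) :
    Integrable fun t : ℝ => Real.exp (-c * |t|) := by
  rw [← integrableOn_univ, ← Iic_union_Ioi (a := (0 : ℝ)), integrableOn_union]
  constructor
  · refine (integrableOn_exp_mul_Iic hc 0).congr_fun (fun t ht => ?_) measurableSet_Iic
    rw [abs_of_nonpos ht]
    ring_nf
  · refine (exp_neg_integrableOn_Ioi 0 hc).congr_fun (fun t ht => ?_) measurableSet_Ioi
    rw [abs_of_pos ht]

theorem integrable_Gamma_mul_expZeta {w : ℂ} (a : ℝ) (hw : 0 < w.re) :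
    Integrable fun t : ℝ =>
      Gamma (linePoint t) * w ^ (-linePoint t) * expZeta a (linePoint t) := by
  have hw0 := ne_zero_of_re_pos hw
  have harg : |arg w| < Real.pi / 2 := abs_arg_lt_pi_div_two_iff.2 (Or.inl hw)
  -- The midpoint of `|arg w|` and `π/2`: this decay beats the growth `e^{|arg w| |t|}` of `w^{-s}`.
  set φ := (|arg w| + Real.pi / 2) / 2 with hφ
  obtain ⟨C, hC0, hC⟩ := exists_norm_Gamma_mul_expZeta_le_exp a (φ := φ) (by positivity) (by linarith)
  have hint := (integrable_exp_neg_mul_abs (c := φ - |arg w|) (by linarith)).const_mul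
    (C * ‖w‖ ^ (3 / 4 : ℝ))
  refine hint.mono' (Continuous.aestronglyMeasurable ?_) (Eventually.of_forall fun t => ?_)
  · refine continuous_iff_continuousAt.2 fun t => ?_
    have hl := continuous_linePoint.continuousAt (x := t)
    have h1 : DifferentiableAt ℂ
        (fun s => Gamma s * w ^ (-s) * expZeta a s) (linePoint t) :=
      ((differentiableAt_Gamma _ (linePoint_ne_neg_nat t)).mul
        (differentiableAt_id.neg.const_cpow (Or.inl hw0))).mul
        (differentiableAt_expZeta a _ (Or.inl (linePoint_ne_one t)))
    exact ContinuousAt.comp (f := linePoint) h1.continuousAt hl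
  · rw [mul_right_comm, norm_mul, norm_cpow_neg_linePoint hw0]
    have h2 : Real.exp (arg w * t) ≤ Real.exp (|arg w| * |t|) := by
      rw [← abs_mul]
      exact Real.exp_le_exp.2 (le_abs_self _)
    calc _ ≤ C * Real.exp (-φ * |t|) * (‖w‖ ^ (3 / 4 : ℝ) * Real.exp (|arg w| * |t|)) := by
          gcongr
          exact hC t
      _ = C * ‖w‖ ^ (3 / 4 : ℝ) * (Real.exp (-φ * |t|) * Real.exp (|arg w| * |t|)) := by ring
      _ = _ := by
          rw [← Real.exp_add]
          ring_nf

/-- Mellin inversion for `expKernel` on the line `Re s = -3/4`. -/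
theorem expKernel_eq_integral {w : ℂ} (a : ℝ) (hw : 0 < w.re) :
    expKernel a w = expKernelResidue a / w + expKernelConst a + 1 / (2 * Real.pi) *
      ∫ t : ℝ, Gamma (linePoint t) * w ^ (-linePoint t) * expZeta a (linePoint t) := by
  set g : ℝ → ℂ := fun t => expKernel a (t * w) - expKernelPolar a w t with hg
  have hline : ∀ t : ℝ, ((-3 / 4 : ℝ) : ℂ) + t * I = linePoint t := fun t => by simp [linePoint]
  have hmel : ∀ t : ℝ, mellin g (linePoint t) =
      Gamma (linePoint t) * w ^ (-linePoint t) * expZeta a (linePoint t) := fun t =>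
    (hasMellin_expKernel_sub_polar a hw (by rw [linePoint_re]; norm_num)
      (by rw [linePoint_re]; norm_num)).2
  have hvert : VerticalIntegrable (mellin g) (-3 / 4) := by
    simp only [VerticalIntegrable, hline, hmel]
    exact integrable_Gamma_mul_expZeta a hw
  have hconv : MellinConvergent g ((-3 / 4 : ℝ) : ℂ) :=
    (hasMellin_expKernel_sub_polar a hw (by rw [ofReal_re]; norm_num)
      (by rw [ofReal_re]; norm_num)).1
  have hcont : ContinuousAt g 1 :=
    ((continuousOn_expKernel_ray a hw).sub (continuousOn_expKernelPolar a w)).continuousAt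
      (Ioi_mem_nhds one_pos)
  -- At `t = 1` the powers of `t` in the polar part and in the inversion integral are all `1`.
  have h := mellinInv_mellin_eq (-3 / 4) g one_pos hconv hvert hcont
  simp only [mellinInv, hline, hmel, ofReal_one, one_cpow, one_smul, real_smul] at h
  simp only [hg, ofReal_one, one_mul, expKernelPolar, one_cpow, mul_one] at h
  rw [eq_sub_iff_add_eq] at h
  rw [← h]
  push_cast
  ring

/-! ### Series over positive integers and periodic twists -/

theorem hasSum_pnat_iff_of_apply_zero {E : Type*} [AddCommMonoid E] [TopologicalSpace E] {f : ℕ → E}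
    (hf : f 0 = 0) {b : E} : HasSum (fun n : ℕ+ => f n) b ↔ HasSum f b := by
  refine PNat.coe_injective.hasSum_iff fun n hn => ?_
  rcases Nat.eq_zero_or_pos n with rfl | h
  · exact hf
  · exact absurd ⟨⟨n, h⟩, rfl⟩ hn

theorem hasSum_pnat_expKernel {w : ℂ} (a : ℝ) (hw : 0 < w.re) :
    HasSum (fun m : ℕ+ => cexp (2 * Real.pi * I * a * (m : ℕ)) * cexp (-((m : ℕ) * w)))
      (expKernel a w) := by
  rw [← Equiv.pnatEquivNat.symm.hasSum_iff]
  convert! hasSum_expKernel a hw using 1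

theorem hasSum_pnat_expZeta {s : ℂ} (a : ℝ) (hs : 1 < s.re) :
    HasSum (fun m : ℕ+ => cexp (2 * Real.pi * I * a * (m : ℕ)) / ((m : ℕ) : ℂ) ^ s)
      (expZeta a s) := by
  have hs0 : s ≠ 0 := ne_zero_of_re_pos (by linarith)
  rw [hasSum_pnat_iff_of_apply_zero (f := fun m : ℕ => cexp (2 * Real.pi * I * a * m) / (m : ℂ) ^ s)
    (by simp [hs0])]
  exact hasSum_expZeta_of_one_lt_re a hs

theorem periodic_cexp_two_pi_I : Function.Periodic (fun a : ℝ => cexp (2 * Real.pi * I * a)) 1 := by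
  intro a
  simp only [ofReal_add, ofReal_one, mul_add, mul_one, exp_add, exp_two_pi_mul_I]

theorem periodic_expKernelResidue : Function.Periodic expKernelResidue 1 := by
  intro a
  have := periodic_cexp_two_pi_I a
  simp only at this
  simp only [expKernelResidue, this]

theorem periodic_expKernelConst : Function.Periodic expKernelConst 1 := by
  intro a
  have := periodic_cexp_two_pi_I a
  simp only at this
  simp only [expKernelConst, exp_neg, this]

theorem coe_add_one_unitAddCircle (a : ℝ) : ((a + 1 : ℝ) : UnitAddCircle) = (a : UnitAddCircle) :=
  AddCircle.coe_add_period 1 a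

/-- A series whose coefficients are twisted by a function of `l h / k` modulo `1`, split
according to `l` modulo `k`. -/
theorem hasSum_mul_periodic {𝕜 : Type*} [RCLike 𝕜] {c : ℕ+ → 𝕜} (hc : Summable c) {f : ℝ → 𝕜}
    (hf : Function.Periodic f 1) (h : ℤ) {k : ℕ} (hk : 0 < k) :
    HasSum (fun l : ℕ+ => c l * f ((l : ℕ) * h / k))
      (∑ r ∈ Finset.range k, f (r * h / k) * ∑' l : ℕ+, if (l : ℕ) % k = r then c l else 0) := by
  have hr : ∀ r ∈ Finset.range k, HasSum (fun l : ℕ+ =>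
      f (r * h / k) * if (l : ℕ) % k = r then c l else 0)
      (f (r * h / k) * ∑' l : ℕ+, if (l : ℕ) % k = r then c l else 0) := fun r _ => by
    have := (hc.indicator {l : ℕ+ | (l : ℕ) % k = r}).hasSum.mul_left (f (r * h / k))
    simpa [indicator_apply] using this
  refine (hasSum_sum hr).congr_fun fun l => ?_
  have hmod : f ((l : ℕ) * h / k) = f (((l : ℕ) % k : ℕ) * h / k) := by
    have hk' : (k : ℝ) ≠ 0 := by positivity
    obtain ⟨q, hq⟩ : ∃ q, (l : ℕ) % k + k * q = l := ⟨_, Nat.mod_add_div (l : ℕ) k⟩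
    have hl : ((l : ℕ) : ℝ) = ((l : ℕ) % k : ℕ) + k * q := by exact_mod_cast hq.symm
    rw [← hf.int_mul (h * q) (((l : ℕ) % k : ℕ) * h / k)]
    congr 1
    rw [hl]
    push_cast
    field_simp
  simp only [mul_ite, mul_zero]
  rw [Finset.sum_ite_eq, if_pos (Finset.mem_range.2 (Nat.mod_lt _ hk)), hmod, mul_comm]

/-! ### The continuation `Q` of the double series -/

/-- The coefficient `x ^ l / l · l^{-s}`. -/
noncomputable def polylogTerm (x s : ℂ) (l : ℕ+) : ℂ :=
  x ^ (l : ℕ) / ((l : ℕ) : ℂ) * ((l : ℕ) : ℂ) ^ (-s)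

theorem norm_polylogTerm (x s : ℂ) (l : ℕ+) :
    ‖polylogTerm x s l‖ = ‖x‖ ^ (l : ℕ) / (l : ℕ) * ((l : ℕ) : ℝ) ^ (-s.re) := by
  rw [polylogTerm, norm_mul, norm_div, norm_pow, norm_natCast,
    norm_natCast_cpow_of_pos l.pos, neg_re]

theorem norm_polylogTerm_le (x : ℂ) {s : ℂ} {N : ℕ} (hs : -N ≤ s.re) (l : ℕ+) :
    ‖polylogTerm x s l‖ ≤ ((l : ℕ) : ℝ) ^ N * ‖x‖ ^ (l : ℕ) := by
  have hl : (1 : ℝ) ≤ (l : ℕ) := by exact_mod_cast l.pos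
  rw [norm_polylogTerm, mul_comm]
  gcongr
  · rw [← Real.rpow_natCast]
    exact Real.rpow_le_rpow_of_exponent_le hl (by linarith)
  · exact div_le_self (by positivity) hl

theorem summable_pow_mul_pow_pnat {x : ℂ} (hx : ‖x‖ < 1) (N : ℕ) :
    Summable fun l : ℕ+ => ((l : ℕ) : ℝ) ^ N * ‖x‖ ^ (l : ℕ) :=
  (summable_pow_mul_geometric_of_norm_lt_one N (r := ‖x‖) (by simpa using hx)).comp_injective
    PNat.coe_injective

theorem summable_norm_polylogTerm {x : ℂ} (hx : ‖x‖ < 1) (s : ℂ) :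
    Summable fun l => ‖polylogTerm x s l‖ := by
  obtain ⟨N, hN⟩ := exists_nat_ge (-s.re)
  exact (summable_pow_mul_pow_pnat hx N).of_nonneg_of_le (fun _ => norm_nonneg _)
    (norm_polylogTerm_le x (by linarith))

theorem summable_polylogTerm {x : ℂ} (hx : ‖x‖ < 1) (s : ℂ) : Summable (polylogTerm x s) :=
  (summable_norm_polylogTerm hx s).of_norm

/-- The part of `∑ x ^ l / l · l^{-s}` with `l ≡ r` modulo `k`. -/
noncomputable def polylogClass (x : ℂ) (k r : ℕ) (s : ℂ) : ℂ :=
  ∑' l : ℕ+, if (l : ℕ) % k = r then polylogTerm x s l else 0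

/-- On `Re s > -N` the terms are dominated by the summable `l^N ‖x‖^l`, and `N` is arbitrary. -/
theorem differentiable_polylogClass {x : ℂ} (hx : ‖x‖ < 1) (k r : ℕ) :
    Differentiable ℂ (polylogClass x k r) := by
  intro s
  obtain ⟨N, hN⟩ := exists_nat_gt (-s.re)
  have hopen : IsOpen {s : ℂ | -(N : ℝ) < s.re} := isOpen_lt continuous_const continuous_re
  refine (differentiableOn_tsum_of_summable_norm (summable_pow_mul_pow_pnat hx N) (fun l => ?_)
    hopen fun l s hs => ?_).differentiableAt (hopen.mem_nhds (show -(N : ℝ) < s.re by linarith))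
  · have : Differentiable ℂ fun s => polylogTerm x s l := fun s =>
      (differentiableAt_id.neg.const_cpow (Or.inl (by simp))).const_mul _
    split_ifs
    · exact this.differentiableOn
    · exact differentiableOn_const _
  · have hs : -(N : ℝ) < s.re := hs
    split_ifs
    · exact norm_polylogTerm_le x hs.le l
    · rw [norm_zero]
      positivity

theorem norm_polylogClass_le {x : ℂ} (hx : ‖x‖ < 1) (k r : ℕ) {s s' : ℂ} (hs : s.re = s'.re) :
    ‖polylogClass x k r s‖ ≤ ∑' l, ‖polylogTerm x s' l‖ := by
  refine tsum_of_norm_bounded (summable_norm_polylogTerm hx s').hasSum fun l => ?_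
  split_ifs
  · rw [norm_polylogTerm, norm_polylogTerm, hs]
  · simp

/-- The analytic continuation of the double series with terms `qTerm x h k s`. -/
noncomputable def qFun (x : ℂ) (h : ℤ) (k : ℕ) (s : ℂ) : ℂ :=
  ∑ r ∈ Finset.range k, expZeta ((r * h / k : ℝ) : UnitAddCircle) s * polylogClass x k r s

theorem hasSum_polylogTerm_mul {x : ℂ} (hx : ‖x‖ < 1) (s : ℂ) {f : ℝ → ℂ}
    (hf : Function.Periodic f 1) (h : ℤ) {k : ℕ} (hk : 0 < k) :
    HasSum (fun l : ℕ+ => polylogTerm x s l * f ((l : ℕ) * h / k))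
      (∑ r ∈ Finset.range k, f (r * h / k) * polylogClass x k r s) :=
  hasSum_mul_periodic (summable_polylogTerm hx s) hf h hk

/-- The finite sum over classes shows holomorphy; this form, one term per `l`, is the one compared
with the other series. -/
theorem hasSum_qFun {x : ℂ} (hx : ‖x‖ < 1) (h : ℤ) {k : ℕ} (hk : 0 < k) (s : ℂ) :
    HasSum (fun l : ℕ+ => polylogTerm x s l *
      expZeta (((l : ℕ) * h / k : ℝ) : UnitAddCircle) s) (qFun x h k s) :=
  hasSum_polylogTerm_mul hx s (f := fun a : ℝ => expZeta (a : UnitAddCircle) s)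
    (fun a => by simp only [coe_add_one_unitAddCircle]) h hk

theorem differentiableOn_qFun {x : ℂ} (hx : ‖x‖ < 1) (h : ℤ) (k : ℕ) :
    DifferentiableOn ℂ (qFun x h k) {1}ᶜ := by
  unfold qFun
  refine DifferentiableOn.fun_sum fun r _ s hs => ?_
  exact ((differentiableAt_expZeta _ s (Or.inl hs)).mul
    (differentiable_polylogClass hx k r s)).differentiableWithinAt

theorem qTerm_eq (x : ℂ) (h : ℤ) (k : ℕ) (s : ℂ) (m l : ℕ+) :
    qTerm x h k s (m, l) = polylogTerm x s l *
      (cexp (2 * Real.pi * I * ((l : ℕ) * h / k : ℝ) * (m : ℕ)) / ((m : ℕ) : ℂ) ^ s) := by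
  rw [qTerm, polylogTerm, natCast_mul_cpow l.ne_zero (by simp), cpow_neg ((m : ℕ) : ℂ)]
  push_cast
  rw [show 2 * Real.pi * I * ((l : ℕ) : ℂ) * ((m : ℕ) : ℂ) * (h : ℂ) / (k : ℂ) =
    2 * Real.pi * I * (((l : ℕ) : ℂ) * h / k) * ((m : ℕ) : ℂ) by ring]
  ring

/-- Interchange of summation for a double series with a geometric-type bound. -/
theorem hasSum_prod_of_hasSum_rows {F : ℕ+ × ℕ+ → ℂ} {u v : ℕ+ → ℝ} (hu : Summable u)
    (hv : Summable v) (hu0 : ∀ m, 0 ≤ u m) (hv0 : ∀ l, 0 ≤ v l)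
    (hF : ∀ m l, ‖F (m, l)‖ ≤ u m * v l) {g : ℕ+ → ℂ} (hg : ∀ l, HasSum (fun m => F (m, l)) (g l))
    {b : ℂ} (hb : HasSum g b) : HasSum F b := by
  have hsum : Summable F :=
    (hu.mul_of_nonneg hv hu0 hv0).of_norm_bounded fun p => hF p.1 p.2
  have hswap : HasSum (fun p : ℕ+ × ℕ+ => F (p.2, p.1)) (∑' p, F p) :=
    (Equiv.prodComm ℕ+ ℕ+).hasSum_iff.2 hsum.hasSum
  rw [hb.unique (hswap.prod_fiberwise hg)]
  exact hsum.hasSum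

theorem norm_cexp_two_pi_I_mul_mul_natCast (a : ℝ) (m : ℕ) :
    ‖cexp (2 * Real.pi * I * a * m)‖ = 1 := by
  simpa [mul_assoc] using norm_cexp_two_pi_I_mul (a * m)

theorem hasSum_qTerm {x : ℂ} (hx : ‖x‖ < 1) (h : ℤ) {k : ℕ} (hk : 0 < k) {s : ℂ}
    (hs : 1 < s.re) : HasSum (qTerm x h k s) (qFun x h k s) := by
  have hu : Summable fun m : ℕ+ => 1 / ((m : ℕ) : ℝ) ^ s.re :=
    (Real.summable_one_div_nat_rpow.2 hs).comp_injective PNat.coe_injective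
  refine hasSum_prod_of_hasSum_rows hu (summable_norm_polylogTerm hx s) (fun m => by positivity)
    (fun l => norm_nonneg _) (fun m l => ?_) (fun l => ?_) (hasSum_qFun hx h hk s)
  · rw [qTerm_eq, norm_mul, norm_div, norm_cexp_two_pi_I_mul_mul_natCast,
      norm_natCast_cpow_of_pos m.pos, mul_comm]
  · simp only [qTerm_eq]
    exact (hasSum_pnat_expZeta _ hs).mul_left _

/-! ### Residue at `1` and value at `0` of `Q` -/

theorem cexp_two_pi_I_eq_one_iff {h : ℤ} {k : ℕ} (hk : 0 < k) (hcop : IsCoprime h (k : ℤ)) (l : ℕ) :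
    cexp (2 * Real.pi * I * ((l * h / k : ℝ) : ℂ)) = 1 ↔ k ∣ l := by
  have hk' : (k : ℂ) ≠ 0 := by simpa using hk.ne'
  rw [exp_eq_one_iff]
  constructor
  · rintro ⟨n, hn⟩
    rw [mul_comm (n : ℂ)] at hn
    have h1 := mul_left_cancel₀ two_pi_I_ne_zero hn
    push_cast at h1
    rw [div_eq_iff hk'] at h1
    have h2 : (l : ℤ) * h = n * k := by exact_mod_cast h1
    exact_mod_cast hcop.symm.dvd_of_dvd_mul_right (Dvd.intro_left n h2.symm)
  · rintro ⟨m, rfl⟩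
    refine ⟨m * h, ?_⟩
    push_cast
    field_simp

theorem expKernelResidue_mul_div {h : ℤ} {k : ℕ} (hk : 0 < k) (hcop : IsCoprime h (k : ℤ))
    (l : ℕ) : expKernelResidue (l * h / k) = if k ∣ l then 1 else 0 := by
  simp only [expKernelResidue, cexp_two_pi_I_eq_one_iff hk hcop]

theorem expKernelConst_mul_div {h : ℤ} {k : ℕ} (hk : 0 < k) (hcop : IsCoprime h (k : ℤ))
    (l : ℕ) : expKernelConst (l * h / k) = if k ∣ l then -1 / 2 else
      1 / (cexp (-(2 * Real.pi * I * (l : ℂ) * (h : ℂ) / (k : ℂ))) - 1) := by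
  simp only [expKernelConst, cexp_two_pi_I_eq_one_iff hk hcop]
  push_cast
  rw [← mul_div_assoc, ← mul_assoc]

theorem hasSum_pnat_of_multiples {g : ℕ → ℂ} {k : ℕ} (hk : 0 < k) {b : ℂ}
    (hb : HasSum (fun n : ℕ+ => g (k * n)) b) :
    HasSum (fun l : ℕ+ => if k ∣ (l : ℕ) then g l else 0) b := by
  have hinj : Function.Injective fun n : ℕ+ => k.toPNat hk * n := mul_right_injective _
  refine (hinj.hasSum_iff fun l hl => if_neg fun ⟨n, hn⟩ => hl ?_).1 (hb.congr_fun fun n => ?_)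
  · exact if_pos (dvd_mul_right _ _)
  · exact ⟨⟨n, Nat.pos_of_ne_zero fun h0 => l.ne_zero (by rw [hn, h0, mul_zero])⟩,
      PNat.eq hn.symm⟩

theorem norm_pow_lt_one {x : ℂ} (hx : ‖x‖ < 1) {k : ℕ} (hk : 0 < k) : ‖x ^ k‖ < 1 := by
  rw [norm_pow]
  exact pow_lt_one₀ (norm_nonneg _) hx hk.ne'

theorem summable_dilog {y : ℂ} (hy : ‖y‖ < 1) :
    Summable fun n : ℕ+ => y ^ (n : ℕ) / ((n : ℕ) : ℂ) ^ 2 := by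
  refine (summable_polylogTerm hy 1).congr fun n => ?_
  rw [polylogTerm, cpow_neg_one]
  field_simp

/-- Only the multiples `l = k n` have a nonzero residue, and they contribute `x^{kn} / (kn)^2`. -/
theorem hasSum_polylogTerm_mul_residue {h : ℤ} {k : ℕ} (hk : 0 < k) (hcop : IsCoprime h (k : ℤ))
    {x : ℂ} (hx : ‖x‖ < 1) :
    HasSum (fun l : ℕ+ => polylogTerm x 1 l * expKernelResidue ((l : ℕ) * h / k))
      (dilog (x ^ k) / (k : ℂ) ^ 2) := by
  have hk' : (k : ℂ) ≠ 0 := by simpa using hk.ne'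
  have h1 := (summable_dilog (norm_pow_lt_one hx hk)).hasSum.div_const ((k : ℂ) ^ 2)
  refine (hasSum_pnat_of_multiples (g := fun l => x ^ l / (l : ℂ) ^ 2) hk
    (h1.congr_fun fun n => ?_)).congr_fun fun l => ?_
  · push_cast
    rw [pow_mul]
    field_simp
  · rw [expKernelResidue_mul_div hk hcop, polylogTerm, cpow_neg_one, mul_ite, mul_one, mul_zero]
    split_ifs
    · field_simp
    · rfl

theorem polylogTerm_zero_mul_const {h : ℤ} {k : ℕ} (hk : 0 < k) (hcop : IsCoprime h (k : ℤ))
    (x : ℂ) (l : ℕ+) (hl : ¬ k ∣ (l : ℕ)) :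
    polylogTerm x 0 l * expKernelConst ((l : ℕ) * h / k) = wTerm x h k l := by
  rw [polylogTerm, expKernelConst_mul_div hk hcop, if_neg hl, wTerm, neg_zero, cpow_zero, mul_one]

theorem hasSum_nat_iff_pnat_wTerm (x : ℂ) (h : ℤ) (k : ℕ) (b : ℂ) :
    HasSum (fun l : {l : ℕ // ¬ k ∣ l} => wTerm x h k l) b ↔
      HasSum (fun l : ℕ+ => if k ∣ (l : ℕ) then 0 else wTerm x h k l) b := by
  rw [hasSum_pnat_iff_of_apply_zero (f := fun l : ℕ => if k ∣ l then 0 else wTerm x h k l)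
    (by simp)]
  have := hasSum_subtype_iff_indicator (f := fun l : ℕ => wTerm x h k l) (a := b)
    (s := {l : ℕ | ¬ k ∣ l})
  refine Iff.trans this ?_
  congr! 1
  ext l
  by_cases hl : k ∣ l <;> simp [hl]

theorem summable_wTerm {h : ℤ} {k : ℕ} (hk : 0 < k) (hcop : IsCoprime h (k : ℤ)) {x : ℂ}
    (hx : ‖x‖ < 1) : Summable (fun l : {l : ℕ // ¬ k ∣ l} => wTerm x h k l) := by
  have h1 := (hasSum_polylogTerm_mul hx 0 periodic_expKernelConst h hk).summable.indicator
    {l : ℕ+ | ¬ k ∣ (l : ℕ)}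
  refine ⟨_, (hasSum_nat_iff_pnat_wTerm x h k _).2 (h1.congr fun l => ?_).hasSum⟩
  by_cases hl : k ∣ (l : ℕ)
  · simp [hl]
  · simp [hl, polylogTerm_zero_mul_const hk hcop x l hl]

/-- The multiples of `k` carry the constant `-1/2` and sum to the logarithm in `w_{h,k}`; the other
`l` give its series. -/
theorem hasSum_polylogTerm_mul_const {h : ℤ} {k : ℕ} (hk : 0 < k) (hcop : IsCoprime h (k : ℤ))
    {x : ℂ} (hx : ‖x‖ < 1) :
    HasSum (fun l : ℕ+ => polylogTerm x 0 l * expKernelConst ((l : ℕ) * h / k))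
      (wConst x h k) := by
  have hk' : (k : ℂ) ≠ 0 := by simpa using hk.ne'
  have h1 := (hasSum_nat_iff_pnat_wTerm x h k _).1 (summable_wTerm hk hcop hx).hasSum
  have hlog := (hasSum_pnat_iff_of_apply_zero (by simp)).2
    (hasSum_taylorSeries_neg_log (norm_pow_lt_one hx hk))
  have h2 : HasSum (fun l : ℕ+ => if k ∣ (l : ℕ) then x ^ (l : ℕ) / ((l : ℕ) : ℂ) * (-1 / 2) else 0)
      (1 / (2 * (k : ℂ)) * Complex.log (1 - x ^ k)) := by
    refine hasSum_pnat_of_multiples (g := fun l => x ^ l / (l : ℂ) * (-1 / 2)) hk ?_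
    convert! hlog.mul_left (-1 / (2 * (k : ℂ))) using 1
    · ext n
      push_cast
      rw [pow_mul]
      field_simp
    · ring
  refine (h2.add h1).congr_fun fun l => ?_
  by_cases hl : k ∣ (l : ℕ)
  · simp only [hl, if_true, polylogTerm, expKernelConst_mul_div hk hcop, neg_zero, cpow_zero,
      mul_one, add_zero]
  · simp only [hl, if_false, polylogTerm_zero_mul_const hk hcop x l hl, zero_add]

theorem qFun_zero {h : ℤ} {k : ℕ} (hk : 0 < k) (hcop : IsCoprime h (k : ℤ)) {x : ℂ}
    (hx : ‖x‖ < 1) : qFun x h k 0 = wConst x h k := by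
  have h1 := hasSum_qFun hx h hk 0
  simp only [expZeta_apply_zero] at h1
  exact h1.unique (hasSum_polylogTerm_mul_const hk hcop hx)

theorem tendsto_sub_one_mul_qFun {h : ℤ} {k : ℕ} (hk : 0 < k) (hcop : IsCoprime h (k : ℤ)) {x : ℂ}
    (hx : ‖x‖ < 1) :
    Tendsto (fun s : ℂ => (s - 1) * qFun x h k s) (𝓝[≠] 1) (𝓝 (dilog (x ^ k) / (k : ℂ) ^ 2)) := by
  rw [(hasSum_polylogTerm_mul_residue hk hcop hx).unique
    (hasSum_polylogTerm_mul hx 1 periodic_expKernelResidue h hk)]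
  simp only [qFun, Finset.mul_sum, ← mul_assoc]
  exact tendsto_finsetSum _ fun r _ => (tendsto_sub_one_mul_expZeta _).mul
    ((differentiable_polylogClass hx k r).continuous.tendsto 1 |>.mono_left nhdsWithin_le_nhds)

/-! ### The pole at `1` is simple -/

/-- The first term dominates: `|Li₂(y) - y| ≤ |y| (ζ(2) - 1) < |y|`, because `π²/6 < 2`. -/
theorem dilog_ne_zero {y : ℂ} (hy0 : y ≠ 0) (hy : ‖y‖ < 1) : dilog y ≠ 0 := by
  have hsum : HasSum (fun n : ℕ => y ^ n / (n : ℂ) ^ 2) (dilog y) :=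
    (hasSum_pnat_iff_of_apply_zero (by simp)).1 (summable_dilog hy).hasSum
  have h2 := (hasSum_nat_add_iff' 2).2 hsum
  have hz := (hasSum_nat_add_iff' 2).2 hasSum_zeta_two
  have hle := tsum_of_norm_bounded (hz.mul_left ‖y‖) (f := fun n : ℕ => y ^ (n + 2) / ((n + 2 : ℕ) : ℂ) ^ 2)
    fun n => by
      rw [norm_div, norm_pow, norm_pow, norm_natCast, div_eq_mul_one_div]
      gcongr
      calc ‖y‖ ^ (n + 2) ≤ ‖y‖ ^ 1 := pow_le_pow_of_le_one (norm_nonneg _) hy.le (by omega)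
        _ = ‖y‖ := pow_one _
  rw [h2.tsum_eq] at hle
  simp only [Finset.sum_range_succ, Finset.sum_range_zero] at hle
  intro h0
  norm_num [h0] at hle
  have hpos : 0 < ‖y‖ := norm_pos_iff.2 hy0
  have hpi := Real.pi_lt_d2
  have hpi0 := Real.pi_pos
  nlinarith [mul_pos hpos hpi0]

/-- By removable singularities `(s - c) f(s)` extends analytically to `c`, with nonzero value `b`.
-/
theorem meromorphicOrderAt_eq_neg_one {f : ℂ → ℂ} {c b : ℂ} (hf : DifferentiableOn ℂ f {c}ᶜ)
    (hb : b ≠ 0) (h : Tendsto (fun s => (s - c) * f s) (𝓝[≠] c) (𝓝 b)) :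
    meromorphicOrderAt f c = -1 := by
  set g : ℂ → ℂ := Function.update (fun s => (s - c) * f s) c b with hg
  have hg_ne : ∀ s, s ≠ c → g s = (s - c) * f s := fun s hs => by
    rw [hg, Function.update_of_ne hs]
  have hgc : g c = b := by rw [hg, Function.update_self]
  have hgan : AnalyticAt ℂ g c := by
    refine analyticAt_of_differentiable_on_punctured_nhds_of_continuousAt ?_
      (continuousAt_update_same.2 h)
    filter_upwards [self_mem_nhdsWithin] with s hs
    have hnhds : {c}ᶜ ∈ 𝓝 s := isOpen_compl_singleton.mem_nhds hs
    have hd : DifferentiableAt ℂ (fun s => (s - c) * f s) s :=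
      (differentiableAt_id.sub_const c).mul (hf.differentiableAt hnhds)
    refine hd.congr_of_eventuallyEq ?_
    filter_upwards [hnhds] with t ht using hg_ne t ht
  have hev : ∀ᶠ s in 𝓝[≠] c, f s = (s - c) ^ (-1 : ℤ) • g s := by
    filter_upwards [self_mem_nhdsWithin] with s hs
    have : s - c ≠ 0 := sub_ne_zero.2 hs
    rw [hg_ne s hs, zpow_neg_one, smul_eq_mul, inv_mul_cancel_left₀ this]
  have hmer : MeromorphicAt f c := by
    refine MeromorphicAt.congr (f := fun s => (s - c) ^ (-1 : ℤ) • g s) ?_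
      (hev.mono fun s hs => hs.symm)
    exact (((MeromorphicAt.id c).sub (MeromorphicAt.const c c)).zpow (-1)).smul
      hgan.meromorphicAt
  exact_mod_cast (meromorphicOrderAt_eq_int_iff hmer (n := -1)).2 ⟨g, hgan, by rwa [hgc], hev⟩

/-! ### The logarithm of the product -/

theorem two_pi_mul_re_pos {z : ℂ} (hz : 0 < z.re) : 0 < (2 * Real.pi * z).re := by
  rw [show 2 * (Real.pi : ℂ) * z = ((2 * Real.pi : ℝ) : ℂ) * z by push_cast; ring, re_ofReal_mul]
  positivity

theorem natCast_mul_two_pi_mul_re_pos {z : ℂ} (hz : 0 < z.re) (l : ℕ+) :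
    0 < (((l : ℕ) : ℂ) * (2 * Real.pi * z)).re := by
  rw [natCast_mul_re]
  have : (0 : ℝ) < (l : ℕ) := by exact_mod_cast l.pos
  exact mul_pos this (two_pi_mul_re_pos hz)

theorem cuspPoint_eq (h : ℤ) (k : ℕ) (z : ℂ) :
    cuspPoint h k z = cexp (2 * Real.pi * I * ((h / k : ℝ) : ℂ) + -(2 * Real.pi * z)) := by
  rw [cuspPoint]
  congr 1
  push_cast
  linear_combination 2 * Real.pi * z * I_sq

theorem norm_cuspPoint_lt_one (h : ℤ) (k : ℕ) {z : ℂ} (hz : 0 < z.re) :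
    ‖cuspPoint h k z‖ < 1 := by
  rw [cuspPoint_eq, exp_add, norm_mul, norm_cexp_two_pi_I_mul, one_mul, norm_exp,
    Real.exp_lt_one_iff, neg_re]
  exact neg_lt_zero.2 (two_pi_mul_re_pos hz)

theorem mul_cuspPoint_pow_pow (x : ℂ) (h : ℤ) (k : ℕ) (z : ℂ) (m l : ℕ) :
    (x * cuspPoint h k z ^ m) ^ l / (l : ℂ) = x ^ l / (l : ℂ) *
      (cexp (2 * Real.pi * I * ((l * h / k : ℝ) : ℂ) * m) *
        cexp (-(m * (l * (2 * Real.pi * z))))) := by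
  rw [mul_pow, ← pow_mul, cuspPoint_eq, ← exp_nat_mul, ← exp_add, mul_div_right_comm]
  congr 2
  push_cast
  ring

/-- The logarithm of the product, as a series over `l`. -/
theorem hasProd_partitionGF {x : ℂ} (hx : ‖x‖ < 1) (h : ℤ) (k : ℕ) {z : ℂ} (hz : 0 < z.re) {b : ℂ}
    (hb : HasSum (fun l : ℕ+ => x ^ (l : ℕ) / ((l : ℕ) : ℂ) *
      expKernel ((l : ℕ) * h / k) ((l : ℕ) * (2 * Real.pi * z))) b) :
    HasProd (fun j : ℕ+ => 1 / (1 - x * cuspPoint h k z ^ (j : ℕ))) (cexp b) := by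
  set u := cuspPoint h k z with hu
  have hu1 : ‖u‖ < 1 := norm_cuspPoint_lt_one h k hz
  have hgeom : ∀ y : ℂ, ‖y‖ < 1 → Summable fun m : ℕ+ => ‖y‖ ^ (m : ℕ) := fun y hy =>
    (summable_geometric_of_lt_one (norm_nonneg _) hy).comp_injective PNat.coe_injective
  have hsum : HasSum (fun p : ℕ+ × ℕ+ => (x * u ^ (p.1 : ℕ)) ^ (p.2 : ℕ) / ((p.2 : ℕ) : ℂ)) b := by
    refine hasSum_prod_of_hasSum_rows (hgeom u hu1) (hgeom x hx) (fun _ => by positivity)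
      (fun _ => by positivity) (fun m l => ?_) (fun l => ?_) hb
    · have hl : (1 : ℝ) ≤ (l : ℕ) := by exact_mod_cast l.pos
      rw [norm_div, norm_natCast, norm_pow, norm_mul, norm_pow, mul_pow, ← pow_mul,
        mul_comm (‖x‖ ^ _)]
      refine (div_le_self (by positivity) hl).trans ?_
      gcongr ?_ * _
      exact pow_le_pow_of_le_one (norm_nonneg _) hu1.le (Nat.le_mul_of_pos_right _ l.pos)
    · simp only [hu, mul_cuspPoint_pow_pow]
      exact (hasSum_pnat_expKernel _ (natCast_mul_two_pi_mul_re_pos hz l)).mul_left _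
  have hy : ∀ m : ℕ+, ‖x * u ^ (m : ℕ)‖ < 1 := fun m => by
    rw [norm_mul]
    exact mul_lt_one_of_nonneg_of_lt_one_left (norm_nonneg _) hx (norm_pow_lt_one hu1 m.pos).le
  have hlog : HasSum (fun m : ℕ+ => -log (1 - x * u ^ (m : ℕ))) b :=
    -- Summing over `l` first gives principal logarithms; exponentiating the series then gives the
    -- product, with no choice of branch left.
    hsum.prod_fiberwise fun m => (hasSum_pnat_iff_of_apply_zero (by simp)).2
      (hasSum_taylorSeries_neg_log (hy m))
  convert! hlog.cexp using 1
  ext m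
  have hne : 1 - x * u ^ (m : ℕ) ≠ 0 := fun h0 => by
    have := hy m
    rw [← sub_eq_zero.1 h0, norm_one] at this
    exact lt_irrefl _ this
  rw [Function.comp_apply, exp_neg, exp_log hne, one_div]

/-! ### Termwise integration and the factorization -/

theorem jIntegrand_qFun_eq_sum (x : ℂ) (h : ℤ) (k : ℕ) (z : ℂ) (t : ℝ) :
    jIntegrand (qFun x h k) z (linePoint t) = ∑ r ∈ Finset.range k,
      polylogClass x k r (linePoint t) * (Gamma (linePoint t) * (2 * Real.pi * z) ^ (-linePoint t) *
        expZeta ((r * h / k : ℝ) : UnitAddCircle) (linePoint t)) := by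
  rw [jIntegrand, qFun, Finset.sum_mul, Finset.sum_mul]
  exact Finset.sum_congr rfl fun r _ => by ring

theorem integrable_jIntegrand_qFun {x : ℂ} (hx : ‖x‖ < 1) (h : ℤ) (k : ℕ) {z : ℂ}
    (hz : 0 < z.re) : Integrable fun t : ℝ => jIntegrand (qFun x h k) z (linePoint t) := by
  simp only [jIntegrand_qFun_eq_sum]
  refine integrable_finsetSum _ fun r _ => ?_
  refine (integrable_Gamma_mul_expZeta _ (two_pi_mul_re_pos hz)).bdd_mul
    (c := ∑' l, ‖polylogTerm x (linePoint 0) l‖) ?_ (Eventually.of_forall fun t => ?_)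
  · exact ((differentiable_polylogClass hx k r).continuous.comp
      continuous_linePoint).aestronglyMeasurable
  · exact norm_polylogClass_le hx k r (by rw [linePoint_re, linePoint_re])

theorem hasSum_integral_expZeta {x : ℂ} (hx : ‖x‖ < 1) (h : ℤ) {k : ℕ} (hk : 0 < k) {z : ℂ}
    (hz : 0 < z.re) :
    HasSum (fun l : ℕ+ => x ^ (l : ℕ) / ((l : ℕ) : ℂ) * ∫ t : ℝ, Gamma (linePoint t) *
      ((l : ℕ) * (2 * Real.pi * z)) ^ (-linePoint t) *
      expZeta (((l : ℕ) * h / k : ℝ) : UnitAddCircle) (linePoint t))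
      (∫ t : ℝ, jIntegrand (qFun x h k) z (linePoint t)) := by
  have hw := two_pi_mul_re_pos hz
  set w := 2 * (Real.pi : ℂ) * z with hw_def
  have hw0 : w ≠ 0 := ne_zero_of_re_pos hw
  set G : ℝ → ℝ → ℂ := fun a t =>
    Gamma (linePoint t) * w ^ (-linePoint t) * expZeta (a : UnitAddCircle) (linePoint t) with hG
  have hGint : ∀ a, Integrable (G a) := fun a => integrable_Gamma_mul_expZeta a hw
  set F : ℕ+ → ℝ → ℂ := fun l t => polylogTerm x (linePoint t) l * G ((l : ℕ) * h / k) t with hF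
  have hcont : ∀ l : ℕ+, Continuous fun t => polylogTerm x (linePoint t) l := fun l =>
    continuous_const.mul (continuous_linePoint.neg.const_cpow (Or.inl (by simp)))
  have hnorm : ∀ (l : ℕ+) (t : ℝ),
      ‖polylogTerm x (linePoint t) l‖ = ‖polylogTerm x (linePoint 0) l‖ := fun l t => by
    rw [norm_polylogTerm, norm_polylogTerm, linePoint_re, linePoint_re]
  have hFint : ∀ l, Integrable (F l) := fun l =>
    (hGint _).bdd_mul (hcont l).aestronglyMeasurable
      (Eventually.of_forall fun t => (hnorm l t).le)
  have hFnorm : ∀ l : ℕ+, ∫ t, ‖F l t‖ =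
      ‖polylogTerm x (linePoint 0) l‖ * ∫ t, ‖G ((l : ℕ) * h / k) t‖ := fun l => by
    simp only [hF, norm_mul, hnorm, integral_const_mul]
  have hsum : Summable fun l => ∫ t, ‖F l t‖ := by
    simp only [hFnorm]
    -- The integral of `‖G a t‖` has period `1` in `a`, so it takes finitely many values at `a = l h
    -- / k`.
    exact (hasSum_mul_periodic (summable_norm_polylogTerm hx (linePoint 0))
      (f := fun a => ∫ t, ‖G a t‖) (fun a => by simp only [hG, coe_add_one_unitAddCircle])
      h hk).summable
  have h1 := hasSum_integral_of_summable_integral_norm hFint hsum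
  convert! h1 using 1
  · ext l
    rw [← integral_const_mul]
    refine integral_congr_ae (Eventually.of_forall fun t => ?_)
    simp only [hF, hG, polylogTerm, natCast_mul_cpow l.ne_zero hw0]
    ring
  · refine integral_congr_ae (Eventually.of_forall fun t => ?_)
    have h2 := (hasSum_qFun hx h hk (linePoint t)).mul_left
      (Gamma (linePoint t) * w ^ (-linePoint t))
    simp only [jIntegrand]
    rw [mul_assoc, mul_comm (qFun x h k _), ← h2.tsum_eq]
    refine tsum_congr fun l => ?_
    simp only [hF, hG]
    ring

theorem jFun_eq (Q : ℂ → ℂ) (z : ℂ) :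
    jFun Q z = 1 / (2 * Real.pi) * ∫ t : ℝ, jIntegrand Q z (linePoint t) := by
  have : (Real.pi : ℂ) ≠ 0 := ofReal_ne_zero.2 Real.pi_ne_zero
  rw [jFun, integral_mul_const]
  field_simp

/-- Inversion is applied to each `K_{lh/k}(l w)`. The factor `1/l` in `R/(l w)` turns the weight
`x^l / l` into `x^l / l^2`, which produces the dilogarithm. -/
theorem hasSum_expKernel_factorization {h : ℤ} {k : ℕ} (hk : 0 < k) (hcop : IsCoprime h (k : ℤ))
    {x : ℂ} (hx : ‖x‖ < 1) {z : ℂ} (hz : 0 < z.re) :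
    HasSum (fun l : ℕ+ => x ^ (l : ℕ) / ((l : ℕ) : ℂ) *
      expKernel ((l : ℕ) * h / k) ((l : ℕ) * (2 * Real.pi * z)))
      (wConst x h k + psiFun x k z + jFun (qFun x h k) z) := by
  have hpi : (Real.pi : ℂ) ≠ 0 := ofReal_ne_zero.2 Real.pi_ne_zero
  have hz0 : z ≠ 0 := ne_zero_of_re_pos hz
  have hk0 : (k : ℂ) ≠ 0 := by simpa using hk.ne'
  have h1 := hasSum_polylogTerm_mul_const hk hcop hx
  have h2 := (hasSum_polylogTerm_mul_residue hk hcop hx).mul_right (1 / (2 * Real.pi * z))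
  have h3 := (hasSum_integral_expZeta hx h hk hz).mul_left (1 / (2 * (Real.pi : ℂ)))
  rw [← jFun_eq] at h3
  have hpsi : dilog (x ^ k) / (k : ℂ) ^ 2 * (1 / (2 * Real.pi * z)) = psiFun x k z := by
    rw [psiFun]
    field_simp
  rw [hpsi] at h2
  refine ((h1.add h2).add h3).congr_fun fun l => ?_
  rw [expKernel_eq_integral _ (natCast_mul_two_pi_mul_re_pos hz l), polylogTerm, polylogTerm,
    neg_zero, cpow_zero, cpow_neg_one]
  generalize (∫ t : ℝ, _ : ℂ) = J
  field_simp
  ring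

theorem mainTheorem6 (h : ℤ) (k : ℕ) (hk : 0 < k) (hlt : h < (k : ℤ))
    (hcop : IsCoprime h (k : ℤ)) (x : ℂ) (hx : ‖x‖ < 1) :
    Summable (fun l : {l : ℕ // ¬ k ∣ l} => wTerm x h k l) ∧
    ∃ Q : ℂ → ℂ,
      -- `Q` is the analytic continuation of the double series to `ℂ` without the point `1`
      (∀ s : ℂ, 1 < s.re → HasSum (qTerm x h k s) (Q s)) ∧
      DifferentiableOn ℂ Q {1}ᶜ ∧
      -- simple pole at `1` with the stated residue, and the value at `0`
      (x ≠ 0 → meromorphicOrderAt Q 1 = -1) ∧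
      Filter.Tendsto (fun s : ℂ => (s - 1) * Q s) (nhdsWithin 1 {1}ᶜ)
        (nhds (dilog (x ^ k) / (k : ℂ) ^ 2)) ∧
      Q 0 = wConst x h k ∧
      -- the factorization
      ∀ z : ℂ, 0 < z.re →
        Multipliable (fun j : ℕ+ => 1 / (1 - x * cuspPoint h k z ^ (j : ℕ))) ∧
        MeasureTheory.Integrable (fun t : ℝ => jIntegrand Q z (linePoint t)) ∧
        partitionGF x (cuspPoint h k z) =
          Complex.exp (wConst x h k) * Complex.exp (psiFun x k z) * Complex.exp (jFun Q z) := by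
  have hpole := tendsto_sub_one_mul_qFun hk hcop hx
  refine ⟨summable_wTerm hk hcop hx, qFun x h k, fun s hs => hasSum_qTerm hx h hk hs,
    differentiableOn_qFun hx h k, fun hx0 => ?_, hpole, qFun_zero hk hcop hx, fun z hz => ?_⟩
  · refine meromorphicOrderAt_eq_neg_one (differentiableOn_qFun hx h k) ?_ hpole
    exact div_ne_zero (dilog_ne_zero (pow_ne_zero k hx0) (norm_pow_lt_one hx hk))
      (by simpa using hk.ne')
  · have hprod := hasProd_partitionGF hx h k hz (hasSum_expKernel_factorization hk hcop hx hz)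
    refine ⟨hprod.multipliable, integrable_jIntegrand_qFun hx h k hz, ?_⟩
    rw [partitionGF, hprod.tprod_eq, exp_add, exp_add]
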